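/- For $\lambda>-1/2$ let $w_\lambda(t)=(1-t^2)^{\lambda-1/2}$ on $(-1,1)$, let $c_\lambda=\bigl(\int_{-1}^1 w_\lambda(t)\,dt\bigr)^{-1}$, and let $\|f\|_{\lambda,2}=\bigl(c_\lambda\int_{-1}^1|f|^2w_\lambda\,dt\bigr)^{1/2}$ be the norm of $L^2(w_\lambda)$ (real-valued functions). Let $D_\lambda=(1-t^2)\frac{d^2}{dt^2}-(2\lambda+1)\,t\,\frac{d}{dt}$, whose eigenfunctions are the Gegenbauer polynomials $C_n^\lambda$ (the Chebyshev polynomials $T_n$ if $\lambda=0$), with eigenvalues $-n(n+2\lambda)$, $n\ge 0$. For $r>0$, $(-D_\lambda)^r$ is the operator in $L^2(w_\lambda)$ that multiplies the $n$-th coefficient of the Gegenbauer expansion by $(n(n+2\lambda))^r$, and $W_2^r(w_\lambda)$ is the space of all $f\in L^2(w_\lambda)$ with $(-D_\lambda)^r f\in L^2(w_\lambda)$. A number $C>0$ is called admissible in the Hardy--Rellich inequality for $\lambda$ if $$\int_{-1}^1|f|^2w_\lambda\,dt\le C\int_{-1}^1(1-t)\,\bigl|(-D_\lambda)^{1/2}f\bigr|^2w_\lambda\,dt$$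 for all $f\in W_2^1(w_\lambda)$ with $\int_{-1}^1 f\,w_\lambda\,dt=0$. Theorem. For every $\lambda>-1/2$ there is a constant $B_\lambda>0$ such that $$\Bigl(c_\lambda\int_{-1}^1(1-t)\,|f|^2w_\lambda\,dt\Bigr)\Bigl(c_\lambda\int_{-1}^1\bigl|(-D_\lambda)^{1/2}f\bigr|^2w_\lambda\,dt\Bigr)\ge B_\lambda$$ for all $f\in W_2^{1/2}(w_\lambda)$ (in particular for all $f\in W_2^1(w_\lambda)$) with $\int_{-1}^1 f\,w_\lambda\,dt=0$ and $\|f\|_{\lambda,2}=1$. Here $B_\lambda=2-\frac{2\sqrt6}{3}$ for $\lambda=\frac12$, and $B_\lambda=C_\lambda^{-1}$ for $\lambda\ne\frac12$, where $C_\lambda$ is the least admissible constant in the Hardy--Rellich inequality for $\lambda$, which exists. In particular, $B_\lambda=(2\lambda-1)^2/8$ for $0\le\lambda\le\frac32$, $\lambda\ne\frac12$. -/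

import Mathlib

open MeasureTheory

noncomputable section

/-- The Gegenbauer weight `w_l(t) = (1 - t ^ 2) ^ (l - 1 / 2)` on `(-1, 1)`. -/
def gegenbauerWeight (l t : ℝ) : ℝ := (1 - t ^ 2) ^ (l - 1 / 2)

/-- The normalization constant `c_l = 1 / ∫_{-1}^1 w_l(t) dt`. -/
def gegenbauerNormConst (l : ℝ) : ℝ := (∫ t in (-1 : ℝ)..1, gegenbauerWeight l t)⁻¹

/-- The measure `c_l w_l(t) dt` on `[-1, 1]`; the norm of `L^2` of this measure is
`‖f‖_{l,2} = (c_l ∫_{-1}^1 |f(t)| ^ 2 w_l(t) dt) ^ (1 / 2)`. -/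
def gegenbauerMeasure (l : ℝ) : Measure ℝ :=
  (volume.restrict (Set.Ioo (-1 : ℝ) 1)).withDensity
    (fun t => ENNReal.ofReal (gegenbauerNormConst l * gegenbauerWeight l t))

/-- The Gegenbauer polynomials in the normalization with value `1` at `t = 1`, that is,
`C_n^l(t) / C_n^l(1)` for `l ≠ 0` and the Chebyshev polynomial `T_n` for `l = 0`,
through their three-term recurrence. -/
def gegenbauerPoly (l : ℝ) : ℕ → Polynomial ℝ
  | 0 => 1
  | 1 => Polynomial.X
  | (n + 2) => Polynomial.C ((n : ℝ) + 1 + 2 * l)⁻¹ *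
      (Polynomial.C (2 * ((n : ℝ) + 1 + l)) * Polynomial.X * gegenbauerPoly l (n + 1)
        - Polynomial.C ((n : ℝ) + 1) * gegenbauerPoly l n)

/-- The operator `D_l = (1 - t ^ 2) d²/dt² - (2 l + 1) t d/dt` on polynomials. -/
def gegenbauerOp (l : ℝ) (p : Polynomial ℝ) : Polynomial ℝ :=
  (1 - Polynomial.X ^ 2) * p.derivative.derivative
    - Polynomial.C (2 * l + 1) * Polynomial.X * p.derivative

/-- `g = (-D_l) ^ r f` in `L^2`, for `r ≠ 0`: the operator multiplies the `n`-th Gegenbauer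
coefficient by `(n (n + 2 l)) ^ r` for `n ≥ 1` and annihilates the coefficient with `n = 0`
(in Lean, `0 ^ r = 0` for `r ≠ 0`). The function `g` is determined almost everywhere by `f`. -/
def IsGegenbauerPower (l r : ℝ) (f g : ℝ → ℝ) : Prop :=
  MemLp f 2 (gegenbauerMeasure l) ∧ MemLp g 2 (gegenbauerMeasure l) ∧
    ∀ n : ℕ, ∫ t, g t * (gegenbauerPoly l n).eval t ∂(gegenbauerMeasure l) =
      ((n : ℝ) * (n + 2 * l)) ^ r *
        ∫ t, f t * (gegenbauerPoly l n).eval t ∂(gegenbauerMeasure l)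

/-- The space `W_2^r(w_l, [-1, 1])` of all `f ∈ L^2(w_l)` with `(-D_l) ^ r f ∈ L^2(w_l)`. -/
def gegenbauerSobolev (l r : ℝ) : Set (ℝ → ℝ) :=
  {f | ∃ g : ℝ → ℝ, IsGegenbauerPower l r f g}

/-- `C` is an admissible constant in the Hardy–Rellich inequality
`∫ |f| ^ 2 w_l ≤ C ∫ (1 - t) |(-D_l) ^ (1 / 2) f| ^ 2 w_l` for mean-zero `f ∈ W_2^1(w_l)`. -/
def IsHardyRellichConst (l C : ℝ) : Prop :=
  0 < C ∧ ∀ f g : ℝ → ℝ, f ∈ gegenbauerSobolev l 1 →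
    ∫ t, f t ∂(gegenbauerMeasure l) = 0 → IsGegenbauerPower l (1 / 2) f g →
      ∫ t, |f t| ^ 2 ∂(gegenbauerMeasure l) ≤
        C * ∫ t, (1 - t) * |g t| ^ 2 ∂(gegenbauerMeasure l)

theorem gegenbauerPoly_recurrence {l : ℝ} (hl : -1 / 2 < l) (n : ℕ) :
    Polynomial.C ((n : ℝ) + 1 + 2 * l) * gegenbauerPoly l (n + 2) =
      Polynomial.C (2 * ((n : ℝ) + 1 + l)) * Polynomial.X * gegenbauerPoly l (n + 1)
        - Polynomial.C ((n : ℝ) + 1) * gegenbauerPoly l n := by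
  have h : ((n : ℝ) + 1 + 2 * l) ≠ 0 := by
    have : (0 : ℝ) ≤ n := Nat.cast_nonneg n
    intro h; linarith
  rw [gegenbauerPoly, ← mul_assoc, ← Polynomial.C_mul, mul_inv_cancel₀ h, Polynomial.C_1, one_mul]

theorem gegenbauerPoly_eval_one {l : ℝ} (hl : -1 / 2 < l) (n : ℕ) :
    (gegenbauerPoly l n).eval 1 = 1 := by
  induction n using Nat.strong_induction_on with
  | _ n ih =>
    match n with
    | 0 => simp [gegenbauerPoly]
    | 1 => simp [gegenbauerPoly]
    | n + 2 =>
      have h : ((n : ℝ) + 1 + 2 * l) ≠ 0 := by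
        have : (0 : ℝ) ≤ n := Nat.cast_nonneg n
        intro h; linarith
      have hr := congrArg (Polynomial.eval 1) (gegenbauerPoly_recurrence hl n)
      simp only [Polynomial.eval_mul, Polynomial.eval_sub, Polynomial.eval_C, Polynomial.eval_X,
        ih n (by omega), ih (n + 1) (by omega)] at hr
      apply mul_left_cancel₀ h
      rw [hr]; ring

theorem gegenbauerPoly_derivative {l : ℝ} (hl : -1 / 2 < l) (n : ℕ) :
    (1 - Polynomial.X ^ 2) * (gegenbauerPoly l (n + 1)).derivative =
      Polynomial.C ((n : ℝ) + 1) *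
        (gegenbauerPoly l n - Polynomial.X * gegenbauerPoly l (n + 1)) ∧
    (1 - Polynomial.X ^ 2) * (gegenbauerPoly l n).derivative =
      Polynomial.C ((n : ℝ) + 2 * l) *
        (Polynomial.X * gegenbauerPoly l n - gegenbauerPoly l (n + 1)) := by
  induction n with
  | zero => constructor <;> simp [gegenbauerPoly]; ring
  | succ n ih =>
    obtain ⟨hA, hB⟩ := ih
    have hne : Polynomial.C ((n : ℝ) + 1 + 2 * l) ≠ 0 := by
      intro hm
      have h0 := Polynomial.C_eq_zero.mp hm
      have : (0 : ℝ) ≤ n := Nat.cast_nonneg n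
      linarith
    have hr := gegenbauerPoly_recurrence hl n
    have hd := congrArg Polynomial.derivative hr
    simp only [Polynomial.derivative_mul, Polynomial.derivative_sub, Polynomial.derivative_C,
      Polynomial.derivative_X, zero_mul, zero_add, mul_one] at hd
    simp only [Nat.cast_add, Nat.cast_one, map_add, map_mul, map_one, map_ofNat]
      at hr hd hA hB hne ⊢
    constructor
    · apply mul_left_cancel₀ hne
      linear_combination (1 - Polynomial.X ^ 2) * hd +
        (Polynomial.C (n : ℝ) + 2) * Polynomial.X * hr +
        2 * (Polynomial.C (n : ℝ) + 1 + Polynomial.C l) * Polynomial.X * hA -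
        (Polynomial.C (n : ℝ) + 1) * hB
    · linear_combination hA + hr

/-- The polynomials `gegenbauerPoly l n` are the eigenfunctions of `D_l`. -/
theorem gegenbauerOp_gegenbauerPoly {l : ℝ} (hl : -1 / 2 < l) (n : ℕ) :
    gegenbauerOp l (gegenbauerPoly l n) =
      -Polynomial.C ((n : ℝ) * (n + 2 * l)) * gegenbauerPoly l n := by
  have hX : (1 - Polynomial.X ^ 2 : Polynomial ℝ) ≠ 0 := by
    intro h
    have := congrArg (Polynomial.eval 0) h
    simp at this
  obtain ⟨hA, hB⟩ := gegenbauerPoly_derivative hl n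
  have hd := congrArg Polynomial.derivative hB
  simp only [Polynomial.derivative_mul, Polynomial.derivative_sub, Polynomial.derivative_C,
    Polynomial.derivative_X, Polynomial.derivative_one, Polynomial.derivative_X_pow, zero_mul,
    zero_add, one_mul, zero_sub, Nat.cast_ofNat, Nat.add_one_sub_one, pow_one] at hd
  apply mul_left_cancel₀ hX
  unfold gegenbauerOp
  simp only [map_add, map_mul, map_one, map_ofNat] at hA hB hd ⊢
  linear_combination (1 - Polynomial.X ^ 2) * hd +
    (Polynomial.C (n : ℝ) + 1) * Polynomial.X * hB -
    (Polynomial.C (n : ℝ) + 2 * Polynomial.C l) * hA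

end

/-! Let `P_n` be the Gegenbauer polynomials normalized by `P_n(1) = 1`, put `e_n = (2l+1)_n / n!`
and `m_n = e_{n-1} + e_n`. Then `m_n` is the inverse squared norm of `P_n`, and multiplication by
`t` acts by `m_n t P_n = e_n P_{n+1} + e_{n-1} P_{n-1}`. For `c_n = ∫ g P_n` this gives `∫ (1-t)|g|²
= Σ e_n (c_n - c_{n+1})²`, the Dirichlet form of a weighted path. With `g = (-D)^{1/2} f`, the
Hardy–Rellich inequality becomes a discrete Hardy inequality, `Σ m_n c_n² / (n(n+2l)) ≤ C Σ e_n (c_n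
- c_{n+1})²` with `c_0 = 0`.

Since `e_n` grows like `n^{2l}`, the critical profile is `n^{1/2-l}`. Positive supersolutions of
this shape prove the inequality for every `l ≠ 1/2` (`isHardyRellichConst_of_supersolution`), with
constant `8/(2l-1)²` when `0 ≤ l ≤ 3/2`. Truncating the critical profile shows that this constant is
optimal there (`IsHardyRellichConst.one_le_mul`).

The uncertainty principle is dual to Hardy–Rellich (`IsHardyRellichConst.uncertainty`): for `h =
(-D)^{-1/2} f` one has `‖f‖² = ⟨h, (-D)^{1/2} f⟩`; apply Cauchy–Schwarz and then Hardy–Rellich to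
`h`.

For `l = 1/2` no Hardy–Rellich constant exists. There a Heisenberg inequality, which is strong when
`∫ t|f|²` is near 1, is combined with the spectral gap, which suffices otherwise
(`IsGegenbauerPower.uncertainty_half`). -/

/-! ### The weight and its probability measure -/

theorem continuous_one_sub_sq_rpow {s : ℝ} (hs : 0 < s) :
    Continuous fun t : ℝ => (1 - t ^ 2) ^ s :=
  (continuous_const.sub (continuous_pow 2)).rpow_const fun _ => Or.inr hs.le

theorem one_sub_sq_pos {t : ℝ} (ht : t ∈ Set.Ioo (-1 : ℝ) 1) : 0 < 1 - t ^ 2 := by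
  nlinarith [ht.1, ht.2]

theorem hasDerivAt_one_sub_sq_rpow (s : ℝ) {t : ℝ} (ht : t ∈ Set.Ioo (-1 : ℝ) 1) :
    HasDerivAt (fun t : ℝ => (1 - t ^ 2) ^ (s + 1)) (-(2 * (s + 1) * t * (1 - t ^ 2) ^ s)) t := by
  have h : HasDerivAt (fun t : ℝ => 1 - t ^ 2) (-(2 * t)) t := by
    simpa using (hasDerivAt_pow 2 t).const_sub 1
  refine (h.rpow_const (p := s + 1) (Or.inl (one_sub_sq_pos ht).ne')).congr_deriv ?_
  rw [add_sub_cancel_right]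
  ring

/-- The Gegenbauer weight is integrable: it is the derivative of an increasing function. -/
theorem intervalIntegrable_gegenbauerWeight {l : ℝ} (hl : -1 / 2 < l) :
    IntervalIntegrable (gegenbauerWeight l) volume (-1) 1 := by
  set s := l - 1 / 2 with hs
  have hs1 : 0 < s + 1 := by rw [hs]; linarith
  have hc := continuous_one_sub_sq_rpow hs1
  have hprim : ∀ t : ℝ, HasDerivAt (fun t => ∫ x in (0 : ℝ)..t, (1 - x ^ 2) ^ (s + 1))
      ((1 - t ^ 2) ^ (s + 1)) t := fun t =>
    intervalIntegral.integral_hasDerivAt_right (hc.intervalIntegrable _ _)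
      hc.aestronglyMeasurable.stronglyMeasurableAtFilter hc.continuousAt
  -- The power `s` may lie in `(-1, 0)`. Subtracting `t(1-t²)^{s+1}` from a multiple of the
  -- primitive of the continuous function `(1-x²)^{s+1}` gives a continuous function on `[-1, 1]`
  -- with derivative `2(s+1)(1-t²)^s`.
  have key := intervalIntegral.integrableOn_deriv_of_nonneg (a := -1) (b := 1)
    (g := fun t => (2 * s + 3) * (∫ x in (0 : ℝ)..t, (1 - x ^ 2) ^ (s + 1)) -
      t * (1 - t ^ 2) ^ (s + 1))
    (g' := fun t => 2 * (s + 1) * (1 - t ^ 2) ^ s) ?_ ?_ ?_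
  · rw [intervalIntegrable_iff_integrableOn_Ioc_of_le (by norm_num)]
    refine IntegrableOn.congr_fun (key.const_mul (2 * (s + 1))⁻¹) (fun t _ => ?_)
      measurableSet_Ioc
    simp only [gegenbauerWeight, ← hs]
    field_simp
  · refine Continuous.continuousOn (Continuous.sub (continuous_const.mul ?_)
      (continuous_id.mul hc))
    exact continuous_iff_continuousAt.2 fun t => (hprim t).continuousAt
  · intro t ht
    have h1 := ((hprim t).const_mul (2 * s + 3)).sub
      ((hasDerivAt_id t).mul (hasDerivAt_one_sub_sq_rpow s ht))
    refine h1.congr_deriv ?_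
    have h2 : (1 - t ^ 2) ^ (s + 1) = (1 - t ^ 2) ^ s * (1 - t ^ 2) :=
      Real.rpow_add_one (one_sub_sq_pos ht).ne' s
    rw [h2, id_eq]
    ring
  · intro t ht
    have := Real.rpow_nonneg (one_sub_sq_pos ht).le s
    positivity

theorem gegenbauerWeight_pos {l t : ℝ} (ht : t ∈ Set.Ioo (-1 : ℝ) 1) : 0 < gegenbauerWeight l t :=
  Real.rpow_pos_of_pos (one_sub_sq_pos ht) _

theorem gegenbauerNormConst_pos {l : ℝ} (hl : -1 / 2 < l) : 0 < gegenbauerNormConst l :=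
  inv_pos.2 <| intervalIntegral.intervalIntegral_pos_of_pos_on
    (intervalIntegrable_gegenbauerWeight hl) (fun _ ht => gegenbauerWeight_pos ht) (by norm_num)

theorem measurable_gegenbauerWeight (l : ℝ) : Measurable (gegenbauerWeight l) := by
  unfold gegenbauerWeight
  fun_prop

theorem integral_gegenbauerMeasure {l : ℝ} (hl : -1 / 2 < l) (f : ℝ → ℝ) :
    ∫ t, f t ∂(gegenbauerMeasure l) =
      gegenbauerNormConst l * ∫ t in (-1 : ℝ)..1, f t * gegenbauerWeight l t := by
  rw [gegenbauerMeasure, integral_withDensity_eq_integral_toReal_smul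
    (((measurable_gegenbauerWeight l).const_mul _).ennreal_ofReal)
    (Filter.Eventually.of_forall fun _ => ENNReal.ofReal_lt_top),
    intervalIntegral.integral_of_le (by norm_num), ← integral_Ioc_eq_integral_Ioo,
    ← integral_const_mul, integral_Ioc_eq_integral_Ioo, integral_Ioc_eq_integral_Ioo]
  refine setIntegral_congr_fun measurableSet_Ioo fun t ht => ?_
  have := (mul_pos (gegenbauerNormConst_pos hl) (gegenbauerWeight_pos (l := l) ht)).le
  simp only [ENNReal.toReal_ofReal this, smul_eq_mul]
  ring

theorem isProbabilityMeasure_gegenbauerMeasure {l : ℝ} (hl : -1 / 2 < l) :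
    IsProbabilityMeasure (gegenbauerMeasure l) := by
  have hint : IntegrableOn (gegenbauerWeight l) (Set.Ioo (-1 : ℝ) 1) := by
    have := intervalIntegrable_gegenbauerWeight hl
    rwa [intervalIntegrable_iff_integrableOn_Ioo_of_le (by norm_num)] at this
  constructor
  rw [gegenbauerMeasure, withDensity_apply _ MeasurableSet.univ, Measure.restrict_univ,
    ← ofReal_integral_eq_lintegral_ofReal (hint.const_mul _), integral_const_mul,
    ← integral_Ioc_eq_integral_Ioo, ← intervalIntegral.integral_of_le (by norm_num),
    gegenbauerNormConst, inv_mul_cancel₀, ENNReal.ofReal_one]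
  · exact (inv_pos.1 (gegenbauerNormConst_pos hl)).ne'
  · refine (ae_restrict_iff' measurableSet_Ioo).2 (Filter.Eventually.of_forall fun t ht => ?_)
    exact (mul_pos (gegenbauerNormConst_pos hl) (gegenbauerWeight_pos ht)).le

theorem ae_mem_Ioo_gegenbauerMeasure (l : ℝ) :
    ∀ᵐ t ∂(gegenbauerMeasure l), t ∈ Set.Ioo (-1 : ℝ) 1 :=
  (withDensity_absolutelyContinuous _ _).ae_le (ae_restrict_mem measurableSet_Ioo)

/-- A continuous function times a function in `L^2` is in `L^2`. -/
theorem memLp_mul_of_continuous {l : ℝ} {f g : ℝ → ℝ} (hg : Continuous g)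
    (hf : MemLp f 2 (gegenbauerMeasure l)) :
    MemLp (fun t => g t * f t) 2 (gegenbauerMeasure l) := by
  obtain ⟨C, hC⟩ := (isCompact_Icc (a := (-1 : ℝ)) (b := 1)).exists_bound_of_continuousOn
    hg.continuousOn
  refine hf.of_le_mul (c := C) (hg.aestronglyMeasurable.mul hf.1) ?_
  filter_upwards [ae_mem_Ioo_gegenbauerMeasure l] with t ht
  rw [norm_mul]
  exact mul_le_mul_of_nonneg_right (hC t (Set.Ioo_subset_Icc_self ht)) (norm_nonneg _)

theorem memLp_of_continuous {l : ℝ} (hl : -1 / 2 < l) {g : ℝ → ℝ} (hg : Continuous g) :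
    MemLp g 2 (gegenbauerMeasure l) := by
  have := isProbabilityMeasure_gegenbauerMeasure hl
  simpa using memLp_mul_of_continuous hg (memLp_const (1 : ℝ))

theorem integrable_of_continuous {l : ℝ} (hl : -1 / 2 < l) {g : ℝ → ℝ} (hg : Continuous g) :
    Integrable g (gegenbauerMeasure l) := by
  have := isProbabilityMeasure_gegenbauerMeasure hl
  exact (memLp_of_continuous hl hg).integrable (by norm_num)

/-! ### Green's formula and orthogonality -/

/-- Integration by parts against the Gegenbauer weight. -/
theorem integral_gegenbauer_divergence {l : ℝ} (hl : -1 / 2 < l) (p : Polynomial ℝ) :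
    ∫ t, ((1 - t ^ 2) * p.derivative.eval t - (2 * l + 1) * t * p.eval t)
      ∂(gegenbauerMeasure l) = 0 := by
  rw [integral_gegenbauerMeasure hl]
  have hs1 : 0 < l - 1 / 2 + 1 := by linarith
  have hc := continuous_one_sub_sq_rpow hs1
  -- The integrand is the derivative of `p (1-t²)^{l+1/2}`, which vanishes at both endpoints because
  -- `l > -1/2`.
  rw [intervalIntegral.integral_eq_sub_of_hasDerivAt_of_le
    (f := fun t => p.eval t * (1 - t ^ 2) ^ (l - 1 / 2 + 1)) (by norm_num)
    (p.continuous.mul hc).continuousOn]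
  · norm_num [Real.zero_rpow hs1.ne']
  · intro t ht
    refine ((p.hasDerivAt t).mul (hasDerivAt_one_sub_sq_rpow (l - 1 / 2) ht)).congr_deriv ?_
    have h2 : (1 - t ^ 2) ^ (l - 1 / 2 + 1) = (1 - t ^ 2) ^ (l - 1 / 2) * (1 - t ^ 2) :=
      Real.rpow_add_one (one_sub_sq_pos ht).ne' _
    rw [h2, gegenbauerWeight]
    ring
  · exact (intervalIntegrable_gegenbauerWeight hl).continuousOn_mul (by fun_prop)

/-- Green's formula for the Gegenbauer operator. -/
theorem integral_gegenbauerOp_mul {l : ℝ} (hl : -1 / 2 < l) (p q : Polynomial ℝ) :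
    ∫ t, (gegenbauerOp l p).eval t * q.eval t ∂(gegenbauerMeasure l) =
      -∫ t, (1 - t ^ 2) * (p.derivative.eval t * q.derivative.eval t) ∂(gegenbauerMeasure l) := by
  have h := integral_gegenbauer_divergence hl (p.derivative * q)
  rw [← add_eq_zero_iff_eq_neg, ← integral_add (integrable_of_continuous hl (by fun_prop))
    (integrable_of_continuous hl (by fun_prop)), ← h]
  congr 1
  ext t
  simp only [gegenbauerOp, Polynomial.derivative_mul, Polynomial.eval_add, Polynomial.eval_sub,
    Polynomial.eval_mul, Polynomial.eval_one, Polynomial.eval_pow, Polynomial.eval_X,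
    Polynomial.eval_C]
  ring

theorem gegenbauerEigenvalue_injective {l : ℝ} (hl : -1 / 2 < l) {n k : ℕ}
    (h : (n : ℝ) * (n + 2 * l) = k * (k + 2 * l)) : n = k := by
  have h1 : ((n : ℝ) - k) * (n + k + 2 * l) = 0 := by linear_combination h
  by_contra hne
  have h2 : (1 : ℝ) ≤ n + k := by exact_mod_cast (by omega : 1 ≤ n + k)
  rcases mul_eq_zero.1 h1 with h3 | h3
  · exact hne (by exact_mod_cast sub_eq_zero.1 h3)
  · linarith

/-- Green's formula makes `D_l` symmetric, and eigenfunctions of a symmetric operator with distinct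
eigenvalues are orthogonal. -/
theorem integral_gegenbauerPoly_mul_of_ne {l : ℝ} (hl : -1 / 2 < l) {n k : ℕ} (hnk : n ≠ k) :
    ∫ t, (gegenbauerPoly l n).eval t * (gegenbauerPoly l k).eval t ∂(gegenbauerMeasure l) = 0 := by
  have h1 := integral_gegenbauerOp_mul hl (gegenbauerPoly l n) (gegenbauerPoly l k)
  have h2 := integral_gegenbauerOp_mul hl (gegenbauerPoly l k) (gegenbauerPoly l n)
  simp only [gegenbauerOp_gegenbauerPoly hl, Polynomial.eval_mul, Polynomial.eval_neg,
    Polynomial.eval_C, mul_assoc, integral_const_mul] at h1 h2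
  simp only [mul_comm ((gegenbauerPoly l k).derivative.eval _),
    mul_comm ((gegenbauerPoly l k).eval _)] at h2
  rw [← h2] at h1
  by_contra hne
  have h3 := mul_right_cancel₀ hne (by linear_combination h1 :
    -(((n : ℝ) * (n + 2 * l))) * _ = -((k : ℝ) * (k + 2 * l)) * _)
  exact hnk (gegenbauerEigenvalue_injective hl (neg_injective h3))

/-! ### Multiplication by `t` and the norms of the polynomials -/

/-- The weights `(2 l + 1)_n / n!` of the Dirichlet form of multiplication by `1 - t`. -/
noncomputable def gegenbauerEdge (l : ℝ) : ℕ → ℝ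
  | 0 => 1
  | n + 1 => gegenbauerEdge l n * ((n + 1 + 2 * l) / (n + 1))

/-- The inverse of the squared norm of `gegenbauerPoly l n`. -/
noncomputable def gegenbauerMass (l : ℝ) : ℕ → ℝ
  | 0 => 1
  | n + 1 => gegenbauerEdge l n * (2 * (n + 1 + l) / (n + 1))

theorem gegenbauerEdge_pos {l : ℝ} (hl : -1 / 2 < l) (n : ℕ) : 0 < gegenbauerEdge l n := by
  induction n with
  | zero => simp [gegenbauerEdge]
  | succ n ih =>
    have : (0 : ℝ) < n + 1 + 2 * l := by
      have : (0 : ℝ) ≤ n := n.cast_nonneg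
      linarith
    rw [gegenbauerEdge]
    positivity

theorem gegenbauerMass_pos {l : ℝ} (hl : -1 / 2 < l) (n : ℕ) : 0 < gegenbauerMass l n := by
  cases n with
  | zero => simp [gegenbauerMass]
  | succ n =>
    have : (0 : ℝ) < n + 1 + l := by
      have : (0 : ℝ) ≤ n := n.cast_nonneg
      linarith
    have := gegenbauerEdge_pos hl n
    rw [gegenbauerMass]
    positivity

/-- The mass of a vertex is the sum of its two edge weights, which is what turns multiplication by
`1 - t` into the Laplacian of a weighted path. -/
theorem gegenbauerMass_succ (l : ℝ) (n : ℕ) :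
    gegenbauerMass l (n + 1) = gegenbauerEdge l n + gegenbauerEdge l (n + 1) := by
  rw [gegenbauerMass, gegenbauerEdge]
  have : (n : ℝ) + 1 ≠ 0 := by positivity
  field_simp
  ring

/-- Multiplication by `t` in the basis of Gegenbauer polynomials, zeroth case. -/
theorem gegenbauerMass_mul_X_zero (l t : ℝ) :
    gegenbauerMass l 0 * (t * (gegenbauerPoly l 0).eval t) =
      gegenbauerEdge l 0 * (gegenbauerPoly l 1).eval t := by
  simp [gegenbauerMass, gegenbauerEdge, gegenbauerPoly]

theorem gegenbauerMass_mul_X_succ {l : ℝ} (hl : -1 / 2 < l) (t : ℝ) (n : ℕ) :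
    gegenbauerMass l (n + 1) * (t * (gegenbauerPoly l (n + 1)).eval t) =
      gegenbauerEdge l (n + 1) * (gegenbauerPoly l (n + 2)).eval t +
        gegenbauerEdge l n * (gegenbauerPoly l n).eval t := by
  have h := congrArg (Polynomial.eval t) (gegenbauerPoly_recurrence hl n)
  simp only [Polynomial.eval_mul, Polynomial.eval_sub, Polynomial.eval_C, Polynomial.eval_X] at h
  have h1 : (n : ℝ) + 1 ≠ 0 := by positivity
  rw [gegenbauerMass, gegenbauerEdge]
  field_simp
  linear_combination -gegenbauerEdge l n * h

theorem integral_gegenbauerPoly_one_sq {l : ℝ} (hl : -1 / 2 < l) :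
    (2 * (1 + l)) * ∫ t, (gegenbauerPoly l 1).eval t * (gegenbauerPoly l 1).eval t
      ∂(gegenbauerMeasure l) = 1 := by
  have := isProbabilityMeasure_gegenbauerMeasure hl
  have h := integral_gegenbauer_divergence hl Polynomial.X
  have h2 : ∀ t : ℝ, (1 - t ^ 2) * (Polynomial.X : Polynomial ℝ).derivative.eval t -
      (2 * l + 1) * t * (Polynomial.X : Polynomial ℝ).eval t = 1 - (2 * (1 + l)) * (t * t) := by
    intro t
    simp
    ring
  simp only [h2] at h
  rw [integral_sub (integrable_const _) (integrable_of_continuous hl (by fun_prop)),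
    integral_const_mul] at h
  simp [gegenbauerPoly] at h ⊢
  linarith

theorem gegenbauerMass_mul_integral_sq {l : ℝ} (hl : -1 / 2 < l) (n : ℕ) :
    gegenbauerMass l n * ∫ t, (gegenbauerPoly l n).eval t * (gegenbauerPoly l n).eval t
      ∂(gegenbauerMeasure l) = 1 := by
  have := isProbabilityMeasure_gegenbauerMeasure hl
  have hi : ∀ i j, Integrable (fun t => (gegenbauerPoly l i).eval t * (gegenbauerPoly l j).eval t)
      (gegenbauerMeasure l) := fun i j => integrable_of_continuous hl (by fun_prop)
  induction n with
  | zero => simp [gegenbauerMass, gegenbauerPoly]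
  | succ n ih =>
    cases n with
    | zero =>
      have := integral_gegenbauerPoly_one_sq hl
      simpa [gegenbauerMass, gegenbauerEdge] using this
    | succ n =>
      -- Letting `t` act on either factor evaluates `J` in two ways; comparing them shows that mass
      -- times squared norm does not depend on the index.
      set J := ∫ t, t * ((gegenbauerPoly l (n + 1)).eval t * (gegenbauerPoly l (n + 2)).eval t)
        ∂(gegenbauerMeasure l) with hJ
      have h1 : gegenbauerMass l (n + 1) * J = gegenbauerEdge l (n + 1) *
          ∫ t, (gegenbauerPoly l (n + 2)).eval t * (gegenbauerPoly l (n + 2)).eval t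
            ∂(gegenbauerMeasure l) := by
        rw [hJ, ← integral_const_mul]
        rw [integral_congr_ae (g := fun t => gegenbauerEdge l (n + 1) *
          ((gegenbauerPoly l (n + 2)).eval t * (gegenbauerPoly l (n + 2)).eval t) +
          gegenbauerEdge l n * ((gegenbauerPoly l n).eval t * (gegenbauerPoly l (n + 2)).eval t))
          (Filter.Eventually.of_forall fun t => ?_),
          integral_add ((hi _ _).const_mul _) ((hi _ _).const_mul _), integral_const_mul,
          integral_const_mul, integral_gegenbauerPoly_mul_of_ne hl (by omega : n ≠ n + 2)]
        · ring
        · linear_combination (gegenbauerPoly l (n + 2)).eval t * gegenbauerMass_mul_X_succ hl t n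
      have h2 : gegenbauerMass l (n + 2) * J = gegenbauerEdge l (n + 1) *
          ∫ t, (gegenbauerPoly l (n + 1)).eval t * (gegenbauerPoly l (n + 1)).eval t
            ∂(gegenbauerMeasure l) := by
        rw [hJ, ← integral_const_mul]
        rw [integral_congr_ae (g := fun t => gegenbauerEdge l (n + 2) *
          ((gegenbauerPoly l (n + 1)).eval t * (gegenbauerPoly l (n + 3)).eval t) +
          gegenbauerEdge l (n + 1) *
            ((gegenbauerPoly l (n + 1)).eval t * (gegenbauerPoly l (n + 1)).eval t))
          (Filter.Eventually.of_forall fun t => ?_),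
          integral_add ((hi _ _).const_mul _) ((hi _ _).const_mul _), integral_const_mul,
          integral_const_mul, integral_gegenbauerPoly_mul_of_ne hl (by omega : n + 1 ≠ n + 3)]
        · ring
        · linear_combination (gegenbauerPoly l (n + 1)).eval t *
            gegenbauerMass_mul_X_succ hl t (n + 1)
      have he := (gegenbauerEdge_pos hl (n + 1)).ne'
      apply mul_left_cancel₀ he
      linear_combination -gegenbauerMass l (n + 2) * h1 + gegenbauerMass l (n + 1) * h2 +
        gegenbauerEdge l (n + 1) * ih

/-! ### Coefficients, completeness and Parseval's formula -/

/-- The integrals of `f` against the Gegenbauer polynomials. -/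
noncomputable def gegenbauerCoeff (l : ℝ) (f : ℝ → ℝ) (n : ℕ) : ℝ :=
  ∫ t, f t * (gegenbauerPoly l n).eval t ∂(gegenbauerMeasure l)

theorem integrable_mul_of_continuous {l : ℝ} (hl : -1 / 2 < l) {f g : ℝ → ℝ} (hg : Continuous g)
    (hf : MemLp f 2 (gegenbauerMeasure l)) :
    Integrable (fun t => f t * g t) (gegenbauerMeasure l) :=
  hf.integrable_mul (memLp_of_continuous hl hg)

theorem gegenbauerCoeff_mul_X_zero (l : ℝ) (f : ℝ → ℝ) :
    gegenbauerMass l 0 * gegenbauerCoeff l (fun t => t * f t) 0 =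
      gegenbauerEdge l 0 * gegenbauerCoeff l f 1 := by
  rw [gegenbauerCoeff, gegenbauerCoeff, ← integral_const_mul, ← integral_const_mul]
  congr 1
  ext t
  linear_combination f t * gegenbauerMass_mul_X_zero l t

theorem gegenbauerCoeff_mul_X_succ {l : ℝ} (hl : -1 / 2 < l) {f : ℝ → ℝ}
    (hf : MemLp f 2 (gegenbauerMeasure l)) (n : ℕ) :
    gegenbauerMass l (n + 1) * gegenbauerCoeff l (fun t => t * f t) (n + 1) =
      gegenbauerEdge l (n + 1) * gegenbauerCoeff l f (n + 2) +
        gegenbauerEdge l n * gegenbauerCoeff l f n := by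
  have hi : ∀ i, Integrable (fun t => f t * (gegenbauerPoly l i).eval t) (gegenbauerMeasure l) :=
    fun i => integrable_mul_of_continuous hl (by fun_prop) hf
  rw [gegenbauerCoeff, gegenbauerCoeff, gegenbauerCoeff, ← integral_const_mul,
    ← integral_const_mul, ← integral_const_mul,
    ← integral_add ((hi _).const_mul _) ((hi _).const_mul _)]
  congr 1
  ext t
  linear_combination f t * gegenbauerMass_mul_X_succ hl t n

/-- By the recurrence, each coefficient of `t f` is a combination of neighbouring coefficients of
`f`. So vanishing passes to `t^k f`, and then to integrals against all polynomials. -/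
theorem gegenbauerCoeff_pow_mul_eq_zero {l : ℝ} (hl : -1 / 2 < l) {f : ℝ → ℝ}
    (hf : MemLp f 2 (gegenbauerMeasure l)) (h0 : ∀ n, gegenbauerCoeff l f n = 0) (k n : ℕ) :
    gegenbauerCoeff l (fun t => t ^ k * f t) n = 0 := by
  induction k generalizing n with
  | zero => simpa using h0 n
  | succ k ih =>
    have hk : MemLp (fun t => t ^ k * f t) 2 (gegenbauerMeasure l) :=
      memLp_mul_of_continuous (by fun_prop) hf
    have he : (fun t : ℝ => t ^ (k + 1) * f t) = fun t => t * (t ^ k * f t) := by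
      ext t
      ring
    rw [he]
    apply mul_left_cancel₀ (gegenbauerMass_pos hl n).ne'
    cases n with
    | zero => rw [gegenbauerCoeff_mul_X_zero, ih, mul_zero, mul_zero]
    | succ n =>
      rw [gegenbauerCoeff_mul_X_succ hl hk, ih, ih]
      ring

theorem integral_mul_polynomial_eq_zero {l : ℝ} (hl : -1 / 2 < l) {f : ℝ → ℝ}
    (hf : MemLp f 2 (gegenbauerMeasure l)) (h0 : ∀ n, gegenbauerCoeff l f n = 0)
    (p : Polynomial ℝ) : ∫ t, f t * p.eval t ∂(gegenbauerMeasure l) = 0 := by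
  induction p using Polynomial.induction_on' with
  | add p q hp hq =>
    simp only [Polynomial.eval_add, mul_add]
    rw [integral_add (integrable_mul_of_continuous hl (by fun_prop) hf)
      (integrable_mul_of_continuous hl (by fun_prop) hf), hp, hq, add_zero]
  | monomial k a =>
    have h := gegenbauerCoeff_pow_mul_eq_zero hl hf h0 k 0
    simp only [gegenbauerCoeff, gegenbauerPoly, Polynomial.eval_one, mul_one] at h
    rw [← mul_zero a, ← h, ← integral_const_mul]
    congr 1
    ext t
    simp only [Polynomial.eval_monomial]
    ring

/-- The Gegenbauer polynomials are complete in `L^2`. -/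
theorem ae_eq_zero_of_gegenbauerCoeff_eq_zero {l : ℝ} (hl : -1 / 2 < l) {f : ℝ → ℝ}
    (hf : MemLp f 2 (gegenbauerMeasure l)) (h0 : ∀ n, gegenbauerCoeff l f n = 0) :
    ∀ᵐ t ∂(gegenbauerMeasure l), f t = 0 := by
  have hP := isProbabilityMeasure_gegenbauerMeasure hl
  have hfi : Integrable f (gegenbauerMeasure l) := hf.integrable (by norm_num)
  -- It suffices to test against smooth `g`. Weierstrass approximation on `[-1, 1]` replaces `g` by
  -- a polynomial, with an error of at most a small multiple of the `L^1` norm of `f`.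
  refine ae_eq_zero_of_integral_contDiff_smul_eq_zero hfi.locallyIntegrable fun g hg _ => ?_
  rw [← abs_nonpos_iff]
  refine le_of_forall_pos_le_add fun ε hε => ?_
  set K := ∫ t, |f t| ∂(gegenbauerMeasure l) with hK
  have hK0 : 0 ≤ K := integral_nonneg fun _ => abs_nonneg _
  obtain ⟨p, hp⟩ := exists_polynomial_near_of_continuousOn (-1) 1 g hg.continuous.continuousOn
    (ε / (K + 1)) (by positivity)
  have h1 : ∫ t, g t • f t ∂(gegenbauerMeasure l) =
      ∫ t, f t * (g t - p.eval t) ∂(gegenbauerMeasure l) := by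
    simp only [mul_sub]
    rw [integral_sub (integrable_mul_of_continuous hl hg.continuous hf)
      (integrable_mul_of_continuous hl (by fun_prop) hf),
      integral_mul_polynomial_eq_zero hl hf h0, sub_zero]
    simp [mul_comm]
  rw [h1, zero_add, ← Real.norm_eq_abs]
  calc ‖∫ t, f t * (g t - p.eval t) ∂(gegenbauerMeasure l)‖
      ≤ ∫ t, |f t| * (ε / (K + 1)) ∂(gegenbauerMeasure l) := by
        refine norm_integral_le_of_norm_le (hfi.abs.mul_const _) ?_
        filter_upwards [ae_mem_Ioo_gegenbauerMeasure l] with t ht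
        rw [Real.norm_eq_abs, abs_mul, abs_sub_comm]
        exact mul_le_mul_of_nonneg_left (hp t (Set.Ioo_subset_Icc_self ht)).le (abs_nonneg _)
    _ = K * (ε / (K + 1)) := by rw [integral_mul_const]
    _ ≤ ε := by
        rw [mul_div_assoc', div_le_iff₀ (by positivity)]
        nlinarith

theorem memLp_gegenbauerPoly {l : ℝ} (hl : -1 / 2 < l) (n : ℕ) :
    MemLp (fun t => √(gegenbauerMass l n) * (gegenbauerPoly l n).eval t) 2
      (gegenbauerMeasure l) :=
  memLp_of_continuous hl (by fun_prop)

/-- The normalized Gegenbauer polynomials as elements of `L^2`. -/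
noncomputable def gegenbauerLp {l : ℝ} (hl : -1 / 2 < l) (n : ℕ) : Lp ℝ 2 (gegenbauerMeasure l) :=
  (memLp_gegenbauerPoly hl n).toLp _

theorem inner_gegenbauerLp {l : ℝ} (hl : -1 / 2 < l) (n : ℕ) {f : ℝ → ℝ}
    (x : Lp ℝ 2 (gegenbauerMeasure l)) (hx : x =ᵐ[gegenbauerMeasure l] f) :
    inner ℝ (gegenbauerLp hl n) x = √(gegenbauerMass l n) * gegenbauerCoeff l f n := by
  rw [L2.inner_def, gegenbauerCoeff, ← integral_const_mul]
  refine integral_congr_ae ?_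
  filter_upwards [hx, (memLp_gegenbauerPoly hl n).coeFn_toLp] with t h1 h2
  rw [h1, gegenbauerLp, h2]
  simp only [RCLike.inner_apply, conj_trivial]
  ring

theorem orthonormal_gegenbauerLp {l : ℝ} (hl : -1 / 2 < l) : Orthonormal ℝ (gegenbauerLp hl) := by
  rw [orthonormal_iff_ite]
  intro i j
  rw [inner_gegenbauerLp hl i (gegenbauerLp hl j) (memLp_gegenbauerPoly hl j).coeFn_toLp,
    gegenbauerCoeff]
  simp only [mul_assoc, integral_const_mul]
  split_ifs with h
  · subst h
    rw [← mul_assoc, Real.mul_self_sqrt (gegenbauerMass_pos hl i).le,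
      gegenbauerMass_mul_integral_sq hl]
  · rw [integral_gegenbauerPoly_mul_of_ne hl (Ne.symm h)]
    ring

theorem span_gegenbauerLp_orthogonal {l : ℝ} (hl : -1 / 2 < l) :
    (Submodule.span ℝ (Set.range (gegenbauerLp hl)))ᗮ = ⊥ := by
  rw [Submodule.eq_bot_iff]
  intro x hx
  rw [Submodule.mem_orthogonal] at hx
  have h0 : ∀ n, gegenbauerCoeff l x n = 0 := fun n => by
    have h := hx _ (Submodule.subset_span ⟨n, rfl⟩)
    rw [inner_gegenbauerLp hl n x Filter.EventuallyEq.rfl] at h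
    exact (mul_eq_zero.1 h).resolve_left (Real.sqrt_pos.2 (gegenbauerMass_pos hl n)).ne'
  exact (Lp.eq_zero_iff_ae_eq_zero).2 (ae_eq_zero_of_gegenbauerCoeff_eq_zero hl (Lp.memLp x) h0)

noncomputable def gegenbauerBasis {l : ℝ} (hl : -1 / 2 < l) :
    HilbertBasis ℕ ℝ (Lp ℝ 2 (gegenbauerMeasure l)) :=
  HilbertBasis.mkOfOrthogonalEqBot (orthonormal_gegenbauerLp hl) (span_gegenbauerLp_orthogonal hl)

theorem gegenbauerBasis_apply {l : ℝ} (hl : -1 / 2 < l) (n : ℕ) :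
    gegenbauerBasis hl n = gegenbauerLp hl n := by
  rw [gegenbauerBasis, HilbertBasis.coe_mkOfOrthogonalEqBot]

theorem inner_toLp_gegenbauerMeasure {l : ℝ} {f g : ℝ → ℝ}
    (hf : MemLp f 2 (gegenbauerMeasure l)) (hg : MemLp g 2 (gegenbauerMeasure l)) :
    inner ℝ (hf.toLp f) (hg.toLp g) = ∫ t, f t * g t ∂(gegenbauerMeasure l) := by
  rw [L2.inner_def]
  refine integral_congr_ae ?_
  filter_upwards [hf.coeFn_toLp, hg.coeFn_toLp] with t h1 h2
  rw [h1, h2]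
  simp [mul_comm]

/-- The Cauchy–Schwarz inequality. -/
theorem sq_integral_mul_le {l : ℝ} {f g : ℝ → ℝ}
    (hf : MemLp f 2 (gegenbauerMeasure l)) (hg : MemLp g 2 (gegenbauerMeasure l)) :
    (∫ t, f t * g t ∂(gegenbauerMeasure l)) ^ 2 ≤
      (∫ t, |f t| ^ 2 ∂(gegenbauerMeasure l)) * ∫ t, |g t| ^ 2 ∂(gegenbauerMeasure l) := by
  have h := real_inner_mul_inner_self_le (hf.toLp f) (hg.toLp g)
  rw [inner_toLp_gegenbauerMeasure, inner_toLp_gegenbauerMeasure,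
    inner_toLp_gegenbauerMeasure] at h
  simp only [sq_abs]
  simpa only [sq] using h

/-- Parseval's formula for Gegenbauer expansions. -/
theorem hasSum_gegenbauerCoeff_mul {l : ℝ} (hl : -1 / 2 < l) {f g : ℝ → ℝ}
    (hf : MemLp f 2 (gegenbauerMeasure l)) (hg : MemLp g 2 (gegenbauerMeasure l)) :
    HasSum (fun n => gegenbauerMass l n * gegenbauerCoeff l f n * gegenbauerCoeff l g n)
      (∫ t, f t * g t ∂(gegenbauerMeasure l)) := by
  have h := (gegenbauerBasis hl).hasSum_inner_mul_inner (hf.toLp f) (hg.toLp g)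
  have hterm : (fun n => gegenbauerMass l n * gegenbauerCoeff l f n * gegenbauerCoeff l g n) =
      fun n => inner ℝ (hf.toLp f) (gegenbauerBasis hl n) *
        inner ℝ (gegenbauerBasis hl n) (hg.toLp g) := by
    ext n
    rw [gegenbauerBasis_apply, real_inner_comm, inner_gegenbauerLp hl n _ hf.coeFn_toLp,
      inner_gegenbauerLp hl n _ hg.coeFn_toLp]
    linear_combination -gegenbauerCoeff l f n * gegenbauerCoeff l g n *
      Real.mul_self_sqrt (gegenbauerMass_pos hl n).le
  rw [hterm, ← inner_toLp_gegenbauerMeasure hf hg]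
  exact h

theorem hasSum_gegenbauerCoeff_sq {l : ℝ} (hl : -1 / 2 < l) {f : ℝ → ℝ}
    (hf : MemLp f 2 (gegenbauerMeasure l)) :
    HasSum (fun n => gegenbauerMass l n * gegenbauerCoeff l f n ^ 2)
      (∫ t, |f t| ^ 2 ∂(gegenbauerMeasure l)) := by
  simp only [sq_abs]
  simpa only [sq, mul_assoc] using hasSum_gegenbauerCoeff_mul hl hf hf

/-- The Riesz–Fischer theorem for Gegenbauer expansions. -/
theorem exists_gegenbauerCoeff_eq {l : ℝ} (hl : -1 / 2 < l) {c : ℕ → ℝ}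
    (hc : Summable fun n => gegenbauerMass l n * c n ^ 2) :
    ∃ f : ℝ → ℝ, MemLp f 2 (gegenbauerMeasure l) ∧ ∀ n, gegenbauerCoeff l f n = c n := by
  have hmem : Memℓp (fun n => √(gegenbauerMass l n) * c n) 2 := by
    rw [memℓp_gen_iff (by norm_num)]
    convert hc using 1
    ext n
    rw [ENNReal.toReal_ofNat, Real.rpow_ofNat, Real.norm_eq_abs, sq_abs, mul_pow,
      Real.sq_sqrt (gegenbauerMass_pos hl n).le]
  set x := (gegenbauerBasis hl).repr.symm ⟨_, hmem⟩ with hx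
  refine ⟨x, Lp.memLp x, fun n => ?_⟩
  have h1 := (gegenbauerBasis hl).repr_apply_apply x n
  rw [hx, LinearIsometryEquiv.apply_symm_apply, ← hx, gegenbauerBasis_apply,
    inner_gegenbauerLp hl n x Filter.EventuallyEq.rfl] at h1
  exact (mul_left_cancel₀ (Real.sqrt_pos.2 (gegenbauerMass_pos hl n)).ne' h1).symm

/-! ### The quadratic form of `1 - t` and powers of `-D` on coefficients -/

theorem gegenbauerEdge_le_mass {l : ℝ} (hl : -1 / 2 < l) (n : ℕ) :
    gegenbauerEdge l n ≤ gegenbauerMass l n := by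
  cases n with
  | zero => simp [gegenbauerEdge, gegenbauerMass]
  | succ n =>
    rw [gegenbauerMass_succ]
    linarith [gegenbauerEdge_pos hl n]

theorem gegenbauerEdge_le_mass_succ {l : ℝ} (hl : -1 / 2 < l) (n : ℕ) :
    gegenbauerEdge l n ≤ gegenbauerMass l (n + 1) := by
  rw [gegenbauerMass_succ]
  linarith [gegenbauerEdge_pos hl (n + 1)]

/-- The quadratic form of multiplication by `t` in terms of Gegenbauer coefficients. -/
theorem hasSum_gegenbauerEdge {l : ℝ} (hl : -1 / 2 < l) {f : ℝ → ℝ}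
    (hf : MemLp f 2 (gegenbauerMeasure l)) :
    HasSum (fun n => 2 * (gegenbauerEdge l n * gegenbauerCoeff l f n * gegenbauerCoeff l f (n + 1)))
      (∫ t, t * |f t| ^ 2 ∂(gegenbauerMeasure l)) := by
  set x : ℕ → ℝ := fun n => gegenbauerEdge l n * gegenbauerCoeff l f n *
    gegenbauerCoeff l f (n + 1) with hx
  have hsq := (hasSum_gegenbauerCoeff_sq hl hf).summable
  have hsum : Summable x := by
    refine Summable.of_norm_bounded (hsq.add ((summable_nat_add_iff 1).2 hsq)) fun n => ?_
    have h1 := gegenbauerEdge_le_mass hl n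
    have h2 := gegenbauerEdge_le_mass_succ hl n
    have h0 := gegenbauerEdge_pos hl n
    have h3 := mul_le_mul_of_nonneg_right h1 (sq_nonneg (gegenbauerCoeff l f n))
    have h4 := mul_le_mul_of_nonneg_right h2 (sq_nonneg (gegenbauerCoeff l f (n + 1)))
    simp only [hx, Real.norm_eq_abs, abs_le]
    constructor <;>
    nlinarith [mul_nonneg h0.le (sq_nonneg (gegenbauerCoeff l f n + gegenbauerCoeff l f (n + 1))),
      mul_nonneg h0.le (sq_nonneg (gegenbauerCoeff l f n - gegenbauerCoeff l f (n + 1))),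
      mul_nonneg h0.le (sq_nonneg (gegenbauerCoeff l f n)),
      mul_nonneg h0.le (sq_nonneg (gegenbauerCoeff l f (n + 1)))]
  have hX : MemLp (fun t => t * f t) 2 (gegenbauerMeasure l) :=
    memLp_mul_of_continuous continuous_id hf
  have hp := hasSum_gegenbauerCoeff_mul hl hf hX
  -- In Parseval's sum for `f` and `t f` each edge is met from both of its ends. This is the count
  -- from the right end, shifted by one and with nothing at `n = 0`.
  have hshift : HasSum (fun n => if n = 0 then 0 else x (n - 1)) (∑' n, x n) := by
    refine (hasSum_nat_add_iff' 1).1 ?_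
    simpa using hsum.hasSum
  have htot := hsum.hasSum.add hshift
  have hval := hp.unique (htot.congr_fun ?_)
  · have h2 : ∫ t, t * |f t| ^ 2 ∂(gegenbauerMeasure l) = 2 * ∑' n, x n := by
      rw [two_mul, ← hval]
      congr 1
      ext t
      rw [sq_abs]
      ring
    rw [h2]
    exact hsum.hasSum.mul_left 2
  · intro n
    cases n with
    | zero =>
      simp only [hx, if_true]
      linear_combination gegenbauerCoeff l f 0 * gegenbauerCoeff_mul_X_zero l f
    | succ n =>
      simp only [hx, Nat.add_sub_cancel, Nat.succ_ne_zero, if_false]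
      linear_combination gegenbauerCoeff l f (n + 1) * gegenbauerCoeff_mul_X_succ hl hf n

theorem integral_one_sub_mul_sq {l : ℝ} {f : ℝ → ℝ}
    (hf : MemLp f 2 (gegenbauerMeasure l)) :
    ∫ t, (1 - t) * |f t| ^ 2 ∂(gegenbauerMeasure l) =
      ∫ t, |f t| ^ 2 ∂(gegenbauerMeasure l) - ∫ t, t * |f t| ^ 2 ∂(gegenbauerMeasure l) := by
  have h1 : Integrable (fun t => |f t| ^ 2) (gegenbauerMeasure l) := by
    simpa only [sq_abs] using hf.integrable_sq
  have h2 : Integrable (fun t => t * |f t| ^ 2) (gegenbauerMeasure l) := by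
    refine (hf.integrable_mul (memLp_mul_of_continuous continuous_id hf)).congr
      (Filter.Eventually.of_forall fun t => ?_)
    simp only [Pi.mul_apply, id, sq_abs]
    ring
  rw [← integral_sub h1 h2]
  congr 1
  ext t
  ring

theorem gegenbauerEigenvalue_pos {l : ℝ} (hl : -1 / 2 < l) (n : ℕ) :
    0 < ((n + 1 : ℕ) : ℝ) * ((n + 1 : ℕ) + 2 * l) := by
  push_cast
  have : (0 : ℝ) ≤ n := n.cast_nonneg
  have : (0 : ℝ) < n + 1 + 2 * l := by linarith
  positivity

theorem gegenbauerEigenvalue_nonneg {l : ℝ} (hl : -1 / 2 < l) (n : ℕ) :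
    0 ≤ (n : ℝ) * (n + 2 * l) := by
  cases n with
  | zero => simp
  | succ n => exact (gegenbauerEigenvalue_pos hl n).le

theorem IsGegenbauerPower.coeff_sq {l : ℝ} (hl : -1 / 2 < l) {f g : ℝ → ℝ}
    (h : IsGegenbauerPower l (1 / 2) f g) (n : ℕ) :
    gegenbauerCoeff l g n ^ 2 = (n : ℝ) * (n + 2 * l) * gegenbauerCoeff l f n ^ 2 := by
  rw [gegenbauerCoeff, h.2.2 n, mul_pow, ← Real.sqrt_eq_rpow,
    Real.sq_sqrt (gegenbauerEigenvalue_nonneg hl n)]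
  rfl

theorem IsGegenbauerPower.coeff_zero {l r : ℝ} (hr : r ≠ 0) {f g : ℝ → ℝ}
    (h : IsGegenbauerPower l r f g) : gegenbauerCoeff l g 0 = 0 := by
  rw [gegenbauerCoeff, h.2.2 0]
  simp [Real.zero_rpow hr]

theorem gegenbauerCoeff_zero (l : ℝ) (f : ℝ → ℝ) :
    gegenbauerCoeff l f 0 = ∫ t, f t ∂(gegenbauerMeasure l) := by
  simp [gegenbauerCoeff, gegenbauerPoly]

/-! ### Admissible constants from supersolutions -/

/-- A positive supersolution, given by its ratios `ρ k = u (k + 2) / u (k + 1)`, yields a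
discrete Hardy inequality, hence the Hardy–Rellich inequality. -/
theorem isHardyRellichConst_of_supersolution {l κ : ℝ} (hl : -1 / 2 < l) (hκ : 0 < κ) {ρ : ℕ → ℝ}
    (hρ : ∀ k, 0 < ρ k)
    (h0 : (1 + 2 * l) * ρ 0 ≤ 2 * (1 + l) * (1 - κ / (1 + 2 * l)))
    (hs : ∀ k : ℕ, (k + 2 + 2 * l) * ρ (k + 1) + (k + 2) / ρ k ≤
      2 * (k + 2 + l) * (1 - κ / ((k + 2) * (k + 2 + 2 * l)))) :
    IsHardyRellichConst l κ⁻¹ := by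
  refine ⟨inv_pos.2 hκ, fun f g _ hf0 hfg => ?_⟩
  rw [← gegenbauerCoeff_zero] at hf0
  have hg0 := hfg.coeff_zero (by norm_num)
  have hsq := hfg.coeff_sq hl
  have hF := (hasSum_nat_add_iff' 1).2 (hasSum_gegenbauerCoeff_sq hl hfg.1)
  have hG := (hasSum_nat_add_iff' 1).2 (hasSum_gegenbauerCoeff_sq hl hfg.2.1)
  have hE := (hasSum_nat_add_iff' 1).2 (hasSum_gegenbauerEdge hl hfg.2.1)
  simp only [Finset.range_one, Finset.sum_singleton, hf0, hg0, mul_zero, zero_mul, sub_zero,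
    zero_pow two_ne_zero] at hF hG hE
  set a : ℕ → ℝ := fun k => gegenbauerCoeff l g (k + 1) with ha
  -- The edge term on the left is the reserve that pays for the next cross term. With `n = k + 2`,
  -- `hs` is the supersolution condition `e_n u_{n+1} + e_{n-1} u_{n-1} ≤ m_n (1 - κ/(n(n+2l))) u_n`
  -- times `n/(e_{n-1} u_n)`; `h0` is the case `n = 1`, without a left neighbour since `c_0 = 0`.
  have hind : ∀ K : ℕ,
      κ * (∑ k ∈ Finset.range (K + 1),
        gegenbauerMass l (k + 1) * gegenbauerCoeff l f (k + 1) ^ 2) +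
      ∑ k ∈ Finset.range K, 2 * (gegenbauerEdge l (k + 1) * a k * a (k + 1)) +
      gegenbauerEdge l (K + 1) * ρ K * a K ^ 2 ≤
      ∑ k ∈ Finset.range (K + 1), gegenbauerMass l (k + 1) * a k ^ 2 := by
    intro K
    induction K with
    | zero =>
      simp only [zero_add, Finset.range_one, Finset.sum_singleton, Finset.range_zero,
        Finset.sum_empty, add_zero, ha, hsq]
      have h2 : 0 < 1 + 2 * l := by linarith
      simp only [gegenbauerMass, gegenbauerEdge, Nat.cast_one, Nat.cast_zero, zero_add, one_mul,
        div_one]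
      have h3 := mul_le_mul_of_nonneg_right h0
        (mul_nonneg h2.le (sq_nonneg (gegenbauerCoeff l f 1)))
      have h4 : 2 * (1 + l) * (1 - κ / (1 + 2 * l)) *
          ((1 + 2 * l) * gegenbauerCoeff l f 1 ^ 2) =
          2 * (1 + l) * ((1 + 2 * l) * gegenbauerCoeff l f 1 ^ 2) -
          κ * (2 * (1 + l) * gegenbauerCoeff l f 1 ^ 2) := by
        field_simp
      linarith
    | succ K ih =>
      rw [Finset.sum_range_succ _ (K + 1), Finset.sum_range_succ _ (K + 1),
        Finset.sum_range_succ (fun k => 2 * (gegenbauerEdge l (k + 1) * a k * a (k + 1))) K]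
      have he := gegenbauerEdge_pos hl (K + 1)
      have hK : (0 : ℝ) ≤ K := K.cast_nonneg
      have h1 : (0 : ℝ) < K + 2 := by linarith
      have h2 : (0 : ℝ) < K + 2 + 2 * l := by linarith
      have h3 := mul_le_mul_of_nonneg_right (hs K) (mul_nonneg (div_pos he h1).le
        (sq_nonneg (a (K + 1))))
      -- The arithmetic–geometric mean inequality with weight `ρ K`, sharp when `a` is proportional
      -- to the supersolution.
      have hcross : 2 * (gegenbauerEdge l (K + 1) * a K * a (K + 1)) ≤
          gegenbauerEdge l (K + 1) * ρ K * a K ^ 2 +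
          gegenbauerEdge l (K + 1) * (a (K + 1) ^ 2 / ρ K) := by
        have h5 : gegenbauerEdge l (K + 1) * ρ K * a K ^ 2 +
          gegenbauerEdge l (K + 1) * (a (K + 1) ^ 2 / ρ K) -
          2 * (gegenbauerEdge l (K + 1) * a K * a (K + 1)) =
          gegenbauerEdge l (K + 1) / ρ K * (ρ K * a K - a (K + 1)) ^ 2 := by
          have := (hρ K).ne'
          field_simp
          ring
        have h6 : 0 ≤ gegenbauerEdge l (K + 1) / ρ K * (ρ K * a K - a (K + 1)) ^ 2 :=
          mul_nonneg (div_pos he (hρ K)).le (sq_nonneg _)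
        linarith
      have hm : gegenbauerMass l (K + 1 + 1) =
          gegenbauerEdge l (K + 1) * (2 * (K + 2 + l) / (K + 2)) := by
        rw [gegenbauerMass]
        push_cast
        ring_nf
      have hee : gegenbauerEdge l (K + 1 + 1) =
          gegenbauerEdge l (K + 1) * ((K + 2 + 2 * l) / (K + 2)) := by
        rw [gegenbauerEdge.eq_2 l (K + 1)]
        push_cast
        ring_nf
      have haf : a (K + 1) ^ 2 =
          ((K : ℝ) + 2) * (K + 2 + 2 * l) * gegenbauerCoeff l f (K + 1 + 1) ^ 2 := by
        rw [ha]
        simp only [hsq]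
        push_cast
        ring
      have hlow : κ * (gegenbauerMass l (K + 1 + 1) * gegenbauerCoeff l f (K + 1 + 1) ^ 2) +
          gegenbauerEdge l (K + 1) * (a (K + 1) ^ 2 / ρ K) +
          gegenbauerEdge l (K + 1 + 1) * ρ (K + 1) * a (K + 1) ^ 2 ≤
          gegenbauerMass l (K + 1 + 1) * a (K + 1) ^ 2 := by
        have h7 : gegenbauerCoeff l f (K + 1 + 1) ^ 2 =
            a (K + 1) ^ 2 / (((K : ℝ) + 2) * (K + 2 + 2 * l)) := by
          rw [haf]
          field_simp
        rw [h7, hm, hee]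
        have h8 : (((K : ℝ) + 2 + 2 * l) * ρ (K + 1) + (K + 2) / ρ K) *
            (gegenbauerEdge l (K + 1) / (K + 2) * a (K + 1) ^ 2) =
            gegenbauerEdge l (K + 1) * (a (K + 1) ^ 2 / ρ K) +
            gegenbauerEdge l (K + 1) * ((K + 2 + 2 * l) / (K + 2)) * ρ (K + 1) *
              a (K + 1) ^ 2 := by
          have := (hρ K).ne'
          field_simp
          ring
        have h9 : 2 * ((K : ℝ) + 2 + l) * (1 - κ / ((K + 2) * (K + 2 + 2 * l))) *
            (gegenbauerEdge l (K + 1) / (K + 2) * a (K + 1) ^ 2) =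
            gegenbauerEdge l (K + 1) * (2 * (K + 2 + l) / (K + 2)) * a (K + 1) ^ 2 -
            κ * (gegenbauerEdge l (K + 1) * (2 * (K + 2 + l) / (K + 2)) *
              (a (K + 1) ^ 2 / (((K : ℝ) + 2) * (K + 2 + 2 * l)))) := by
          field_simp
        rw [h8, h9] at h3
        linarith
      rw [mul_add]
      linarith
  have hlim := le_of_tendsto_of_tendsto'
    (((hF.tendsto_sum_nat.comp (Filter.tendsto_add_atTop_nat 1)).const_mul κ).add
      hE.tendsto_sum_nat)
    (hG.tendsto_sum_nat.comp (Filter.tendsto_add_atTop_nat 1)) fun K => by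
      have h1 := hind K
      have h2 : 0 ≤ gegenbauerEdge l (K + 1) * ρ K * a K ^ 2 :=
        mul_nonneg (mul_pos (gegenbauerEdge_pos hl _) (hρ K)).le (sq_nonneg _)
      simp only [Function.comp]
      linarith
  rw [integral_one_sub_mul_sq hfg.2.1, inv_mul_eq_div, le_div_iff₀ hκ]
  linarith

theorem supersolution_step_iff {l κ x y n : ℝ} (hn : 0 < n) (hnl : 0 < n + 2 * l)
    (hy : 0 < y) :
    (n + 2 * l) * x + n / y ≤ 2 * (n + l) * (1 - κ / (n * (n + 2 * l))) ↔
      ((n + 2 * l) * x * y + n) * (n * (n + 2 * l)) ≤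
        2 * (n + l) * (n * (n + 2 * l) - κ) * y := by
  have h1 : (n + 2 * l) * x + n / y = ((n + 2 * l) * x * y + n) / y := by field_simp
  have h2 : 2 * (n + l) * (1 - κ / (n * (n + 2 * l))) =
    2 * (n + l) * (n * (n + 2 * l) - κ) / (n * (n + 2 * l)) := by field_simp
  rw [h1, h2, div_le_div_iff₀ hy (by positivity)]

/-- Hardy–Rellich inequality for `l < 1 / 2`. -/
theorem isHardyRellichConst_of_lt_half {l κ : ℝ} (hl : -1 / 2 < l) (hl2 : l < 1 / 2) (hκ : 0 < κ)
    (h : ∀ n : ℝ, 1 ≤ n → 2 * κ * ((n + l) * (n - 1 / 2 - l)) ≤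
      (1 / 2 - l) * (((1 / 2 - l) * (n - 1) + 1 / 2 + 2 * l ^ 2) * (n + 2 * l))) :
    IsHardyRellichConst l κ⁻¹ := by
  have ha : 0 < 1 / 2 - l := by linarith
  -- The supersolution is `u(n) = Γ(n + 1/2 - l)/Γ(n)`, which grows like the critical `n^{1/2-l}`;
  -- hypothesis `h` is what remains after clearing denominators.
  refine isHardyRellichConst_of_supersolution hl hκ
    (ρ := fun k => (k + 1 + (1 / 2 - l)) / (k + 1)) (fun k => by positivity) ?_ fun k => ?_
  · have h1 := h 1 le_rfl
    have h2 : 0 < 1 + 2 * l := by linarith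
    have e : 2 * (1 + l) * (1 - κ / (1 + 2 * l)) = 2 * (1 + l) * (1 + 2 * l - κ) / (1 + 2 * l) := by
      field_simp
    rw [e, le_div_iff₀ h2]
    have h3 : 2 * κ * (1 + l) ≤ (1 / 2 + 2 * l ^ 2) * (1 + 2 * l) := by
      refine le_of_mul_le_mul_left ?_ ha
      linarith
    push_cast
    rw [zero_add, div_one]
    nlinarith
  · have hk : (0 : ℝ) ≤ k := k.cast_nonneg
    have hn : (0 : ℝ) < k + 2 := by linarith
    have hnl : (0 : ℝ) < k + 2 + 2 * l := by linarith
    rw [supersolution_step_iff hn hnl (by positivity)]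
    have h1 := h (k + 2) (by linarith)
    push_cast
    have hk1 : (0 : ℝ) < k + 1 := by linarith
    have e1 : (((k : ℝ) + 2 + 2 * l) * ((k + 1 + 1 + (1 / 2 - l)) / (k + 1 + 1)) *
        ((k + 1 + (1 / 2 - l)) / (k + 1)) + (k + 2)) * ((k + 2) * (k + 2 + 2 * l)) =
        ((k + 2 + 2 * l) * ((k + 2 + (1 / 2 - l)) * (k + 1 + (1 / 2 - l))) +
          (k + 2) ^ 2 * (k + 1)) * (k + 2 + 2 * l) / (k + 1) := by
      have : (k : ℝ) + 1 + 1 = k + 2 := by ring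
      rw [this]
      field_simp
    have e2 : 2 * ((k : ℝ) + 2 + l) * ((k + 2) * (k + 2 + 2 * l) - κ) *
        ((k + 1 + (1 / 2 - l)) / (k + 1)) =
        2 * (k + 2 + l) * ((k + 2) * (k + 2 + 2 * l) - κ) * (k + 1 + (1 / 2 - l)) / (k + 1) := by
      ring
    rw [e1, e2]
    refine div_le_div_of_nonneg_right ?_ hk1.le
    linarith

/-- Only finiteness of the best constant is needed here. The factor `1 + 2l` cannot be avoided:
testing with `P_1` gives `C ≥ 1/(1+2l)`, so `8/(2l-1)²` fails as `l` tends to `-1/2`. -/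
theorem isHardyRellichConst_of_neg {l : ℝ} (hl : -1 / 2 < l) (hl2 : l < 0) :
    IsHardyRellichConst l ((1 / 2 - l) * (1 + 2 * l) / 4)⁻¹ := by
  have ha : 1 / 2 < 1 / 2 - l := by linarith
  have hb : 0 < 1 + 2 * l := by linarith
  refine isHardyRellichConst_of_lt_half hl (by linarith) (by positivity) fun n hn => ?_
  have h1 : (n + l) * (n - 1 / 2 - l) ≤ n * n :=
    mul_le_mul (by linarith) (by linarith) (by linarith) (by linarith)
  have h2 : n / 2 * ((1 + 2 * l) * n) ≤
      ((1 / 2 - l) * (n - 1) + 1 / 2 + 2 * l ^ 2) * (n + 2 * l) :=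
    mul_le_mul (by nlinarith) (by nlinarith) (by positivity) (by nlinarith)
  calc 2 * ((1 / 2 - l) * (1 + 2 * l) / 4) * ((n + l) * (n - 1 / 2 - l))
      ≤ 2 * ((1 / 2 - l) * (1 + 2 * l) / 4) * (n * n) :=
        mul_le_mul_of_nonneg_left h1 (by positivity)
    _ = (1 / 2 - l) * (n / 2 * ((1 + 2 * l) * n)) := by ring
    _ ≤ _ := mul_le_mul_of_nonneg_left h2 (by linarith)

/-- With the critical constant the leading terms in `n` cancel, and the remainder has the factor `3l
+ 1/2`, positive for `l ≥ 0`. -/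
theorem isHardyRellichConst_of_nonneg_of_lt_half {l : ℝ} (hl : 0 ≤ l) (hl2 : l < 1 / 2) :
    IsHardyRellichConst l ((2 * l - 1) ^ 2 / 8)⁻¹ := by
  have ha : 0 < 1 / 2 - l := by linarith
  refine isHardyRellichConst_of_lt_half (by linarith) hl2
    (div_pos (pow_pos (by linarith : 0 < 1 - 2 * l) 2 |>.trans_eq (by ring)) (by norm_num))
    fun n hn => ?_
  have e : 2 * ((2 * l - 1) ^ 2 / 8) * ((n + l) * (n - 1 / 2 - l)) =
      (1 / 2 - l) * ((1 / 2 - l) * ((n + l) * (n - 1 / 2 - l))) := by ring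
  rw [e]
  refine mul_le_mul_of_nonneg_left (sub_nonneg.1 ?_) ha.le
  have e2 : ((1 / 2 - l) * (n - 1) + 1 / 2 + 2 * l ^ 2) * (n + 2 * l) -
      (1 / 2 - l) * ((n + l) * (n - 1 / 2 - l)) = (3 * l + 1 / 2) * (n / 2 + l / 2 + l ^ 2) := by
    ring
  rw [e2]
  positivity

/-- Hardy–Rellich inequality for `l > 1 / 2`, with a constant that is not the best one. -/
theorem isHardyRellichConst_of_half_lt {l : ℝ} (hl : 1 / 2 < l) :
    IsHardyRellichConst l ((l - 1 / 2) ^ 2 / 2 * ((1 + 2 * l) / (1 + l) ^ 2))⁻¹ := by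
  have hd : 0 < l - 1 / 2 := by linarith
  have hl0 : 0 < l := by linarith
  -- The minimum of `n(n+2l)/(n+l)²` over `n ≥ 1`, attained at `n = 1`; it is the loss against the
  -- critical constant.
  set q := (1 + 2 * l) / (1 + l) ^ 2 with hq
  have hq0 : 0 < q := by positivity
  have hqn : ∀ n : ℝ, 1 ≤ n → q * (n + l) ^ 2 ≤ n * (n + 2 * l) := fun n hn => by
    rw [hq, div_mul_eq_mul_div, div_le_iff₀ (by positivity)]
    have : n * (n + 2 * l) * (1 + l) ^ 2 - (1 + 2 * l) * (n + l) ^ 2 =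
      l ^ 2 * ((n - 1) * (n + 2 * l + 1)) := by ring
    have : 0 ≤ l ^ 2 * ((n - 1) * (n + 2 * l + 1)) :=
      mul_nonneg (sq_nonneg l) (mul_nonneg (by linarith) (by linarith))
    linarith
  refine isHardyRellichConst_of_supersolution (by linarith) (by positivity)
    (ρ := fun k => (k + 1 + l / 2 + 3 / 4) / (k + 1 + 3 * l / 2 + 1 / 4))
    (fun k => by positivity) ?_ fun k => ?_
  · have h2 : 0 < 1 + 2 * l := by linarith
    have e : 2 * (1 + l) * (1 - (l - 1 / 2) ^ 2 / 2 * q / (1 + 2 * l)) =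
        2 * (1 + l) - (l - 1 / 2) ^ 2 / (1 + l) := by
      rw [hq]
      field_simp
    rw [e]
    push_cast
    rw [zero_add, ← sub_nonneg]
    have e2 : 2 * (1 + l) - (l - 1 / 2) ^ 2 / (1 + l) -
        (1 + 2 * l) * ((1 + l / 2 + 3 / 4) / (1 + 3 * l / 2 + 1 / 4)) =
        (l ^ 3 / 2 + 15 / 4 * l ^ 2 + 25 / 8 * l + 7 / 16) /
          ((1 + l) * (1 + 3 * l / 2 + 1 / 4)) := by
      have : 1 + 3 * l / 2 + 1 / 4 ≠ 0 := by positivity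
      field_simp
      ring
    rw [e2]
    positivity
  · have hk : (0 : ℝ) ≤ k := k.cast_nonneg
    have h1 := hqn (k + 2) (by linarith)
    push_cast
    set n : ℝ := k + 2 with hn
    have hn2 : 2 ≤ n := by linarith
    have e1 : (k : ℝ) + 1 + 1 = n := by rw [hn]; ring
    have e2 : (k : ℝ) + 1 = n - 1 := by rw [hn]; ring
    rw [e1, e2]
    obtain ⟨A, hA⟩ : ∃ A, A = n + 3 * l / 2 + 1 / 4 := ⟨_, rfl⟩
    obtain ⟨B, hB⟩ : ∃ B, B = n - 1 + l / 2 + 3 / 4 := ⟨_, rfl⟩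
    have hA0 : 0 < A := by linarith
    have hB0 : 0 < B := by linarith
    have p4 : 0 < n * (n + 2 * l) := mul_pos (by linarith) (by linarith)
    -- The shifts in `ρ` differ by `1/2 - l`, the critical exponent, and are chosen so that the left
    -- side is exactly this. As `A + B = 2(n+l)`, also `A B ≤ (n+l)²`.
    have e3 : (n + 2 * l) * ((n + l / 2 + 3 / 4) / A) + n / (B / (n - 1 + 3 * l / 2 + 1 / 4)) =
        2 * (n + l) * (1 - (l - 1 / 2) ^ 2 / 2 / (A * B)) := by
      field_simp
      rw [hA, hB]
      ring
    rw [← hA, ← hB, e3]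
    refine mul_le_mul_of_nonneg_left (sub_le_sub_left ?_ _) (by linarith)
    rw [div_le_div_iff₀ p4 (mul_pos hA0 hB0), mul_assoc]
    refine mul_le_mul_of_nonneg_left (le_trans ?_ h1) (by positivity)
    refine mul_le_mul_of_nonneg_left ?_ hq0.le
    rw [hA, hB]
    nlinarith

/-- Hardy–Rellich inequality with the best constant for `1 / 2 < l ≤ 3 / 2`. -/
theorem isHardyRellichConst_of_half_lt_of_le {l : ℝ} (hl : 1 / 2 < l) (hl2 : l ≤ 3 / 2) :
    IsHardyRellichConst l ((2 * l - 1) ^ 2 / 8)⁻¹ := by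
  have hd : 0 < 2 * l - 1 := by linarith
  -- Again the shifts differ by `1/2 - l`. The first ratio is raised to 1 to relax the condition at
  -- `n = 2`, which the general formula violates at `l = 3/2`; there is room for this at `n = 1`.
  refine isHardyRellichConst_of_supersolution (by linarith) (by positivity)
    (ρ := fun k => if k = 0 then 1 else (k + 1 + 3 * l / 2 + 1 / 4) / (k + 1 + 5 * l / 2 - 1 / 4))
    (fun k => ?_) ?_ fun k => ?_
  · have hk : (0 : ℝ) ≤ k := k.cast_nonneg
    split_ifs
    · exact one_pos
    · exact div_pos (by linarith) (by linarith)
  · have h2 : 0 < 1 + 2 * l := by linarith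
    have e : 2 * (1 + l) * (1 - (2 * l - 1) ^ 2 / 8 / (1 + 2 * l)) =
        2 * (1 + l) * (1 + 2 * l - (2 * l - 1) ^ 2 / 8) / (1 + 2 * l) := by
      field_simp
    rw [if_pos rfl, mul_one, e, le_div_iff₀ h2]
    nlinarith
  · rcases k with _ | k
    · have h2 : 0 < 1 + l := by linarith
      have h3 : 0 < 7 / 4 + 5 * l / 2 := by linarith
      rw [if_neg (by norm_num), if_pos rfl]
      push_cast
      have e1 : (0 + 2 + 2 * l) * ((1 + 1 + 3 * l / 2 + 1 / 4) /
          (1 + 1 + 5 * l / 2 - 1 / 4)) + (0 + 2) / 1 =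
          4 + 2 * l - 2 * (1 + l) * (l - 1 / 2) / (7 / 4 + 5 * l / 2) := by
        have : (1 : ℝ) + 1 + 5 * l / 2 - 1 / 4 = 7 / 4 + 5 * l / 2 := by ring
        rw [this]
        field_simp
        ring
      have e2 : 2 * (0 + 2 + l) * (1 - (2 * l - 1) ^ 2 / 8 / ((0 + 2) * (0 + 2 + 2 * l))) =
          4 + 2 * l - (2 + l) * (l - 1 / 2) ^ 2 / (4 * (1 + l)) := by
        have : (0 : ℝ) + 2 + 2 * l = 2 * (1 + l) := by ring
        rw [this]
        field_simp
        ring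
      rw [e1, e2]
      refine sub_le_sub_left ?_ _
      rw [div_le_div_iff₀ (by positivity) h3]
      have h4 : (2 + l) * (l - 1 / 2) * (7 / 4 + 5 * l / 2) ≤ 2 * (1 + l) * (4 * (1 + l)) := by
        nlinarith
      have := mul_le_mul_of_nonneg_left h4 (by linarith : 0 ≤ l - 1 / 2)
      linarith
    · rw [if_neg (by omega), if_neg (by omega)]
      have hk : (0 : ℝ) ≤ k := k.cast_nonneg
      push_cast
      obtain ⟨n, hn⟩ : ∃ n : ℝ, n = k + 3 := ⟨_, rfl⟩
      have hn2 : 3 ≤ n := by linarith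
      have e1 : (k : ℝ) + 1 + 2 = n := by rw [hn]; ring
      have e2 : (k : ℝ) + 1 + 1 + 1 = n := by rw [hn]; ring
      have e3 : (k : ℝ) + 1 + 1 = n - 1 := by rw [hn]; ring
      rw [e1, e2, e3]
      obtain ⟨A, hA⟩ : ∃ A, A = n + 5 * l / 2 - 1 / 4 := ⟨_, rfl⟩
      obtain ⟨B, hB⟩ : ∃ B, B = n - 1 + 3 * l / 2 + 1 / 4 := ⟨_, rfl⟩
      have hA0 : 0 < A := by linarith
      have hB0 : 0 < B := by linarith
      have p4 : 0 < n * (n + 2 * l) := mul_pos (by linarith) (by linarith)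
      have e4 : (n + 2 * l) * ((n + 3 * l / 2 + 1 / 4) / A) +
          n / (B / (n - 1 + 5 * l / 2 - 1 / 4)) =
          2 * (n + l) - (2 * l - 1) ^ 2 / 4 * ((n + 3 * l) / (A * B)) := by
        field_simp
        rw [hA, hB]
        ring
      have e5 : 2 * (n + l) * (1 - (2 * l - 1) ^ 2 / 8 / (n * (n + 2 * l))) =
          2 * (n + l) - (2 * l - 1) ^ 2 / 4 * ((n + l) / (n * (n + 2 * l))) := by
        field_simp
        ring
      rw [← hA, ← hB, e4, e5]
      refine sub_le_sub_left (mul_le_mul_of_nonneg_left ?_ (by positivity)) _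
      rw [div_le_div_iff₀ p4 (mul_pos hA0 hB0), hA, hB, ← sub_nonneg]
      -- Expansion around `n = 3`, the first index where both ratios follow the general formula;
      -- both parts are nonnegative for `1/2 < l ≤ 3/2`.
      have e6 : (n + 3 * l) * (n * (n + 2 * l)) -
          (n + l) * ((n + 5 * l / 2 - 1 / 4) * (n - 1 + 3 * l / 2 + 1 / 4)) =
          (n - 3) * (n + 3 + (-7 / 4 * l ^ 2 + 13 / 4 * l - 3 / 16)) +
          (135 / 16 + 153 / 16 * l - 3 * l ^ 2 - 15 / 4 * l ^ 3) := by
        ring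
      rw [e6]
      have h1 : l ^ 2 ≤ 3 / 2 * l := by nlinarith
      have h2 : l ^ 3 ≤ 9 / 4 * l := by nlinarith
      exact add_nonneg (mul_nonneg (by linarith) (by linarith)) (by linarith)

theorem exists_isHardyRellichConst {l : ℝ} (hl : -1 / 2 < l) (hl2 : l ≠ 1 / 2) :
    ∃ C, IsHardyRellichConst l C := by
  rcases lt_or_gt_of_ne hl2 with h | h
  · rcases lt_or_ge l 0 with h0 | h0
    · exact ⟨_, isHardyRellichConst_of_neg hl h0⟩
    · exact ⟨_, isHardyRellichConst_of_nonneg_of_lt_half h0 h⟩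
  · exact ⟨_, isHardyRellichConst_of_half_lt h⟩

/-! ### Polynomial test functions and the least admissible constant -/

/-- The polynomial with prescribed Gegenbauer coefficients `c n` for `n < M`. -/
noncomputable def gegenbauerSum (l : ℝ) (c : ℕ → ℝ) (M : ℕ) : Polynomial ℝ :=
  ∑ n ∈ Finset.range M, Polynomial.C (gegenbauerMass l n * c n) * gegenbauerPoly l n

theorem memLp_gegenbauerSum {l : ℝ} (hl : -1 / 2 < l) (c : ℕ → ℝ) (M : ℕ) :
    MemLp (fun t => (gegenbauerSum l c M).eval t) 2 (gegenbauerMeasure l) :=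
  memLp_of_continuous hl (by fun_prop)

theorem gegenbauerCoeff_gegenbauerSum {l : ℝ} (hl : -1 / 2 < l) (c : ℕ → ℝ) (M n : ℕ) :
    gegenbauerCoeff l (fun t => (gegenbauerSum l c M).eval t) n = if n < M then c n else 0 := by
  have h1 : ∀ t : ℝ, (gegenbauerSum l c M).eval t * (gegenbauerPoly l n).eval t =
      ∑ k ∈ Finset.range M, gegenbauerMass l k * c k *
        ((gegenbauerPoly l k).eval t * (gegenbauerPoly l n).eval t) := fun t => by
    rw [gegenbauerSum, Polynomial.eval_finsetSum, Finset.sum_mul]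
    refine Finset.sum_congr rfl fun k _ => ?_
    rw [Polynomial.eval_mul, Polynomial.eval_C]
    ring
  simp only [gegenbauerCoeff, h1]
  rw [integral_finsetSum _ fun k _ =>
    (integrable_of_continuous hl (by fun_prop)).const_mul (gegenbauerMass l k * c k)]
  simp only [integral_const_mul]
  have h2 : ∀ k, gegenbauerMass l k * c k * ∫ t, (gegenbauerPoly l k).eval t *
      (gegenbauerPoly l n).eval t ∂(gegenbauerMeasure l) = if k = n then c n else 0 := fun k => by
    split_ifs with h
    · subst h
      linear_combination c k * gegenbauerMass_mul_integral_sq hl k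
    · rw [integral_gegenbauerPoly_mul_of_ne hl h, mul_zero]
  simp only [h2, Finset.sum_ite_eq', Finset.mem_range]

theorem isGegenbauerPower_gegenbauerSum {l r : ℝ} (hl : -1 / 2 < l) {a d : ℕ → ℝ}
    (h : ∀ n : ℕ, a n = ((n : ℝ) * (n + 2 * l)) ^ r * d n) (M : ℕ) :
    IsGegenbauerPower l r (fun t => (gegenbauerSum l d M).eval t)
      (fun t => (gegenbauerSum l a M).eval t) := by
  refine ⟨memLp_gegenbauerSum hl d M, memLp_gegenbauerSum hl a M, fun n => ?_⟩
  have h1 := gegenbauerCoeff_gegenbauerSum hl a M n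
  have h2 := gegenbauerCoeff_gegenbauerSum hl d M n
  rw [gegenbauerCoeff] at h1 h2
  rw [h1, h2]
  split_ifs
  · exact h n
  · rw [mul_zero]

theorem integral_sq_gegenbauerSum {l : ℝ} (hl : -1 / 2 < l) (c : ℕ → ℝ) (M : ℕ) :
    ∫ t, |(gegenbauerSum l c M).eval t| ^ 2 ∂(gegenbauerMeasure l) =
      ∑ n ∈ Finset.range M, gegenbauerMass l n * c n ^ 2 := by
  refine (hasSum_gegenbauerCoeff_sq hl (memLp_gegenbauerSum hl c M)).unique ?_
  have h1 := hasSum_sum_of_ne_finset_zero (L := .unconditional ℕ) (s := Finset.range M) (f := fun n => gegenbauerMass l n *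
    gegenbauerCoeff l (fun t => (gegenbauerSum l c M).eval t) n ^ 2) fun n hn => by
      simp [gegenbauerCoeff_gegenbauerSum hl, Finset.mem_range.not.1 hn]
  rwa [Finset.sum_congr rfl fun n hn => by
    rw [gegenbauerCoeff_gegenbauerSum hl, if_pos (Finset.mem_range.1 hn)]] at h1

theorem integral_mul_sq_gegenbauerSum {l : ℝ} (hl : -1 / 2 < l) (c : ℕ → ℝ) (M : ℕ) :
    ∫ t, t * |(gegenbauerSum l c (M + 1)).eval t| ^ 2 ∂(gegenbauerMeasure l) =
      ∑ n ∈ Finset.range M, 2 * (gegenbauerEdge l n * c n * c (n + 1)) := by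
  refine (hasSum_gegenbauerEdge hl (memLp_gegenbauerSum hl c (M + 1))).unique ?_
  have h1 := hasSum_sum_of_ne_finset_zero (L := .unconditional ℕ) (s := Finset.range M) (f := fun n => 2 *
    (gegenbauerEdge l n * gegenbauerCoeff l (fun t => (gegenbauerSum l c (M + 1)).eval t) n *
      gegenbauerCoeff l (fun t => (gegenbauerSum l c (M + 1)).eval t) (n + 1))) fun n hn => by
      simp [gegenbauerCoeff_gegenbauerSum hl, Finset.mem_range.not.1 hn]
  rwa [Finset.sum_congr rfl fun n hn => by
    have := Finset.mem_range.1 hn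
    rw [gegenbauerCoeff_gegenbauerSum hl, gegenbauerCoeff_gegenbauerSum hl,
      if_pos (by omega), if_pos (by omega)]] at h1

/-- Expanding the squares collects `e_{n-1} + e_n = m_n` at each vertex; the last term is the
boundary term, absent once `c (M + 1) = 0`. -/
theorem sum_gegenbauerEdge_mul_sq (l : ℝ) (c : ℕ → ℝ) (M : ℕ) :
    ∑ n ∈ Finset.range (M + 1), gegenbauerEdge l n * (c n - c (n + 1)) ^ 2 =
      ∑ n ∈ Finset.range (M + 1), gegenbauerMass l n * c n ^ 2 -
      ∑ n ∈ Finset.range M, 2 * (gegenbauerEdge l n * c n * c (n + 1)) +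
      gegenbauerEdge l M * (c (M + 1) ^ 2 - 2 * (c M * c (M + 1))) := by
  induction M with
  | zero =>
    simp [gegenbauerMass, gegenbauerEdge]
    ring
  | succ M ih =>
    rw [Finset.sum_range_succ, ih, Finset.sum_range_succ _ (M + 1), gegenbauerMass_succ,
      Finset.sum_range_succ (fun n => 2 * (gegenbauerEdge l n * c n * c (n + 1)))]
    ring

/-- An admissible constant in the Hardy–Rellich inequality is admissible in the discrete Hardy
inequality. -/
theorem IsHardyRellichConst.sum_le {l C : ℝ} (hl : -1 / 2 < l) (hC : IsHardyRellichConst l C)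
    {c : ℕ → ℝ} {M : ℕ} (h0 : c 0 = 0) (hM : c (M + 1) = 0) :
    ∑ n ∈ Finset.range (M + 1), gegenbauerMass l n * c n ^ 2 / ((n : ℝ) * (n + 2 * l)) ≤
      C * ∑ n ∈ Finset.range (M + 1), gegenbauerEdge l n * (c n - c (n + 1)) ^ 2 := by
  -- Coefficients of `(-D)^{-1/2}` applied to the polynomial with coefficients `c`; division by zero
  -- gives the required value 0 at `n = 0`.
  set d : ℕ → ℝ := fun n => c n / ((n : ℝ) * (n + 2 * l)) ^ (1 / 2 : ℝ) with hd
  have hcd : ∀ n : ℕ, c n = ((n : ℝ) * (n + 2 * l)) ^ (1 / 2 : ℝ) * d n := fun n => by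
    cases n with
    | zero => simp [hd, h0]
    | succ n =>
      have := (Real.rpow_pos_of_pos (gegenbauerEigenvalue_pos hl n) (1 / 2 : ℝ)).ne'
      rw [hd]
      dsimp only
      field_simp
  have hpow := isGegenbauerPower_gegenbauerSum hl hcd (M + 1)
  have hsob := isGegenbauerPower_gegenbauerSum (r := 1) hl (d := d) (fun _ => rfl) (M + 1)
  have hmean : ∫ t, (gegenbauerSum l d (M + 1)).eval t ∂(gegenbauerMeasure l) = 0 := by
    rw [← gegenbauerCoeff_zero, gegenbauerCoeff_gegenbauerSum hl]
    simp [hd, h0]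
  have h := hC.2 _ _ ⟨_, hsob⟩ hmean hpow
  rw [integral_one_sub_mul_sq hpow.2.1, integral_sq_gegenbauerSum hl, integral_sq_gegenbauerSum hl,
    integral_mul_sq_gegenbauerSum hl] at h
  rw [sum_gegenbauerEdge_mul_sq, hM]
  simp only [mul_zero, ne_eq, OfNat.ofNat_ne_zero, not_false_eq_true, zero_pow, sub_zero, add_zero]
  refine le_trans (le_of_eq (Finset.sum_congr rfl fun n _ => ?_)) h
  rw [hd]
  dsimp only
  rw [div_pow, ← Real.sqrt_eq_rpow, Real.sq_sqrt (gegenbauerEigenvalue_nonneg hl n), mul_div_assoc]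

/-- Tested on `P_1`. This keeps the infimum of the admissible constants positive. -/
theorem IsHardyRellichConst.inv_le {l C : ℝ} (hl : -1 / 2 < l) (hC : IsHardyRellichConst l C) :
    (1 + 2 * l)⁻¹ ≤ C := by
  have h := hC.sum_le hl (c := fun n => if n = 1 then 1 else 0) (M := 1) (by simp) (by simp)
  have h1 : (0 : ℝ) < 1 + 2 * l := by linarith
  have h2 : (0 : ℝ) < 1 + l := by linarith
  simp [Finset.sum_range_succ, gegenbauerMass, gegenbauerEdge] at h
  have h3 : 2 * (1 + l) / (1 + 2 * l) = 2 * (1 + l) * (1 + 2 * l)⁻¹ := div_eq_mul_inv _ _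
  rw [h3] at h
  refine le_of_mul_le_mul_left ?_ (by linarith : 0 < 2 * (1 + l))
  linarith

theorem isLeast_isHardyRellichConst {l : ℝ} (hl : -1 / 2 < l) (hl2 : l ≠ 1 / 2) :
    IsLeast {C : ℝ | IsHardyRellichConst l C} (sInf {C : ℝ | IsHardyRellichConst l C}) := by
  have hne : {C : ℝ | IsHardyRellichConst l C}.Nonempty := exists_isHardyRellichConst hl hl2
  have hbdd : BddBelow {C : ℝ | IsHardyRellichConst l C} := ⟨0, fun C hC => hC.1.le⟩
  refine ⟨⟨?_, fun f g hf hf0 hfg => ?_⟩, fun C hC => csInf_le hbdd hC⟩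
  · have h1 : 0 < (1 + 2 * l)⁻¹ := inv_pos.2 (by linarith)
    exact h1.trans_le (le_csInf hne fun C hC => hC.inv_le hl)
  · have hX : 0 ≤ ∫ t, (1 - t) * |g t| ^ 2 ∂(gegenbauerMeasure l) := by
      refine integral_nonneg_of_ae ?_
      filter_upwards [ae_mem_Ioo_gegenbauerMeasure l] with t ht
      exact mul_nonneg (by linarith [ht.2]) (by positivity)
    rcases hX.eq_or_lt with h | h
    -- A vanishing right side cannot be divided by, but any one admissible constant then forces the
    -- left side to be 0.
    · obtain ⟨C, hC⟩ := hne
      have := hC.2 f g hf hf0 hfg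
      rw [← h] at this ⊢
      simpa using this
    · rw [← div_le_iff₀ h]
      exact le_csInf hne fun C hC => (div_le_iff₀ h).2 (hC.2 f g hf hf0 hfg)

/-! ### Optimality of the critical constant -/

open Filter

/-- The test sequence `√((n + 1) / e n)`, with `e n` the weights `gegenbauerEdge l n`. -/
noncomputable def hardyTest (l : ℝ) (n : ℕ) : ℝ := √((n + 1) / gegenbauerEdge l n)

/-- The ratio of consecutive terms of `hardyTest`. -/
noncomputable def hardyTestRatio (l : ℝ) (n : ℕ) : ℝ := √((n + 2) / (n + 1 + 2 * l))

theorem hardyTest_sq {l : ℝ} (hl : -1 / 2 < l) (n : ℕ) :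
    gegenbauerEdge l n * hardyTest l n ^ 2 = n + 1 := by
  have h := gegenbauerEdge_pos hl n
  rw [hardyTest, Real.sq_sqrt (by positivity)]
  field_simp

theorem hardyTest_succ {l : ℝ} (hl : -1 / 2 < l) (n : ℕ) :
    hardyTest l (n + 1) = hardyTest l n * hardyTestRatio l n := by
  have h := gegenbauerEdge_pos hl n
  have h1 : (0 : ℝ) < n + 1 + 2 * l := by
    have : (0 : ℝ) ≤ n := n.cast_nonneg
    linarith
  rw [hardyTest, hardyTest, hardyTestRatio, ← Real.sqrt_mul (by positivity), gegenbauerEdge]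
  congr 1
  push_cast
  field_simp
  ring

/-- Multiplying by the conjugate `1 + ratio` removes the square roots and leaves a rational function
of `n`. -/
theorem hardyTest_sub_sq {l : ℝ} (hl : -1 / 2 < l) (n : ℕ) :
    gegenbauerEdge l n * (hardyTest l n - hardyTest l (n + 1)) ^ 2 *
      (1 + hardyTestRatio l n) ^ 2 = (n + 1) * ((2 * l - 1) / (n + 1 + 2 * l)) ^ 2 := by
  have h1 : (0 : ℝ) < n + 1 + 2 * l := by
    have : (0 : ℝ) ≤ n := n.cast_nonneg
    linarith
  have hy : hardyTestRatio l n ^ 2 = 1 - (2 * l - 1) / (n + 1 + 2 * l) := by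
    rw [hardyTestRatio, Real.sq_sqrt (by positivity)]
    field_simp
    ring
  rw [hardyTest_succ hl]
  have h2 : gegenbauerEdge l n * (hardyTest l n - hardyTest l n * hardyTestRatio l n) ^ 2 *
      (1 + hardyTestRatio l n) ^ 2 =
      gegenbauerEdge l n * hardyTest l n ^ 2 * (1 - hardyTestRatio l n ^ 2) ^ 2 := by ring
  rw [h2, hardyTest_sq hl, hy]
  ring

theorem hardyTestRatio_nonneg (l : ℝ) (n : ℕ) : 0 ≤ hardyTestRatio l n := Real.sqrt_nonneg _

theorem tendsto_hardyTestRatio (l : ℝ) : Tendsto (hardyTestRatio l) atTop (nhds 1) := by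
  have h : Tendsto (fun n : ℕ => ((n : ℝ) + 2) / (n + (1 + 2 * l))) atTop (nhds 1) := by
    have h1 := (tendsto_add_mul_div_add_mul_atTop_nhds (𝕜 := ℝ) 2 (1 + 2 * l) 1 one_ne_zero)
    simpa [add_comm] using h1
  have h2 := h.sqrt
  rw [Real.sqrt_one] at h2
  refine h2.congr fun n => ?_
  rw [hardyTestRatio, add_assoc (n : ℝ) 1]

theorem hardyTest_sub_sq_le {l : ℝ} (hl : 0 ≤ l) (n : ℕ) :
    gegenbauerEdge l n * (hardyTest l n - hardyTest l (n + 1)) ^ 2 ≤ (2 * l - 1) ^ 2 / (n + 1) := by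
  have hl' : -1 / 2 < l := by linarith
  have hn : (0 : ℝ) < n + 1 := by positivity
  calc gegenbauerEdge l n * (hardyTest l n - hardyTest l (n + 1)) ^ 2
      ≤ gegenbauerEdge l n * (hardyTest l n - hardyTest l (n + 1)) ^ 2 *
        (1 + hardyTestRatio l n) ^ 2 := by
        refine le_mul_of_one_le_right
          (mul_nonneg (gegenbauerEdge_pos hl' n).le (sq_nonneg _)) ?_
        nlinarith [hardyTestRatio_nonneg l n]
    _ = (n + 1) * ((2 * l - 1) ^ 2 / (n + 1 + 2 * l) ^ 2) := by
        rw [hardyTest_sub_sq hl', div_pow]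
    _ ≤ (n + 1) * ((2 * l - 1) ^ 2 / (n + 1) ^ 2) := by
        have h : ((n : ℝ) + 1) ^ 2 ≤ (n + 1 + 2 * l) ^ 2 :=
          pow_le_pow_left₀ hn.le (by linarith) 2
        gcongr
    _ = _ := by field_simp

theorem hardyTest_mass {l : ℝ} (hl : -1 / 2 < l) (n : ℕ) :
    gegenbauerMass l (n + 1) * hardyTest l (n + 1) ^ 2 /
      (((n + 1 : ℕ) : ℝ) * ((n + 1 : ℕ) + 2 * l)) =
      2 * (n + 2) * (n + 1 + l) / ((n + 1) * (n + 1 + 2 * l) ^ 2) := by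
  have hn : (0 : ℝ) ≤ n := n.cast_nonneg
  have h1 : (0 : ℝ) < n + 1 + 2 * l := by linarith
  have h2 := hardyTest_sq hl (n + 1)
  have he := gegenbauerEdge_pos hl n
  rw [gegenbauerEdge] at h2
  rw [gegenbauerMass]
  push_cast at h2 ⊢
  have h3 : hardyTest l (n + 1) ^ 2 =
      (n + 2) * (n + 1) / (gegenbauerEdge l n * (n + 1 + 2 * l)) := by
    rw [eq_div_iff (by positivity)]
    field_simp at h2
    linear_combination h2
  rw [h3]
  field_simp

/-- On the critical profile the energy terms behave like `(2l-1)²/(4n)` and the mass terms like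
`2/n`, so their ratio tends to `(2l-1)²/8`. -/
theorem eventually_hardyTest_le {l C θ : ℝ} (hl : 0 ≤ l) (hC : 0 < C)
    (hθ : C * ((2 * l - 1) ^ 2 / 8) < θ) :
    ∀ᶠ n : ℕ in atTop, C * (gegenbauerEdge l n * (hardyTest l n - hardyTest l (n + 1)) ^ 2) ≤
      θ * (gegenbauerMass l n * hardyTest l n ^ 2 / ((n : ℝ) * (n + 2 * l))) := by
  have hl' : -1 / 2 < l := by linarith
  have hlim : Tendsto (fun n => θ * (1 + hardyTestRatio l n) ^ 2) atTop (nhds (θ * (1 + 1) ^ 2)) :=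
    (((tendsto_hardyTestRatio l).const_add 1).pow 2).const_mul θ
  have hev := hlim.eventually_const_lt (u := C * (2 * l - 1) ^ 2 / 2) (by linarith)
  have hθ0 : 0 < θ := lt_of_le_of_lt (by positivity) hθ
  filter_upwards [hev, eventually_ge_atTop 1] with n hn hn1
  obtain ⟨k, rfl⟩ : ∃ k, n = k + 1 := ⟨n - 1, by omega⟩
  have hy := hardyTestRatio_nonneg l (k + 1)
  have hy2 : 0 < (1 + hardyTestRatio l (k + 1)) ^ 2 := by positivity
  refine le_of_mul_le_mul_right ?_ hy2
  have hk : (0 : ℝ) ≤ k := k.cast_nonneg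
  rw [hardyTest_mass hl', mul_assoc, hardyTest_sub_sq hl']
  push_cast
  set D : ℝ := 2 * ((k : ℝ) + 2) / (k + 1 + 2 * l + 1) ^ 2 with hD
  have hD0 : 0 ≤ D := by positivity
  have h1 : C * (((k : ℝ) + 1 + 1) * ((2 * l - 1) / (k + 1 + 1 + 2 * l)) ^ 2) =
      C * (2 * l - 1) ^ 2 / 2 * D := by
    have : (k : ℝ) + 1 + 1 + 2 * l = k + 1 + 2 * l + 1 := by ring
    rw [hD, this, div_pow]
    field_simp
    ring
  have h2 : D ≤ 2 * ((k : ℝ) + 2) * (k + 1 + l) / ((k + 1) * (k + 1 + 2 * l) ^ 2) := by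
    rw [hD, div_le_div_iff₀ (by positivity) (by positivity)]
    have h3 : ((k : ℝ) + 1) * (k + 1 + 2 * l) ^ 2 ≤ (k + 1 + l) * (k + 1 + 2 * l + 1) ^ 2 := by
      refine mul_le_mul (by linarith) (pow_le_pow_left₀ (by positivity) (by linarith) 2)
        (by positivity) (by positivity)
    have := mul_le_mul_of_nonneg_left h3 (by positivity : 0 ≤ 2 * ((k : ℝ) + 2))
    linarith
  rw [h1]
  calc C * (2 * l - 1) ^ 2 / 2 * D ≤ θ * (1 + hardyTestRatio l (k + 1)) ^ 2 * D :=
        mul_le_mul_of_nonneg_right hn.le hD0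
    _ ≤ θ * (1 + hardyTestRatio l (k + 1)) ^ 2 *
        (2 * ((k : ℝ) + 2) * (k + 1 + l) / ((k + 1) * (k + 1 + 2 * l) ^ 2)) := by
        gcongr
    _ = _ := by ring

theorem hardyTest_mass_ge {l : ℝ} (hl : 0 ≤ l) (hl2 : l ≤ 3 / 2) (n : ℕ) :
    1 / (2 * (((n + 1 : ℕ) : ℝ) + 1)) ≤ gegenbauerMass l (n + 1) * hardyTest l (n + 1) ^ 2 /
      (((n + 1 : ℕ) : ℝ) * ((n + 1 : ℕ) + 2 * l)) := by
  have hn : (0 : ℝ) ≤ n := n.cast_nonneg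
  rw [hardyTest_mass (by linarith)]
  push_cast
  rw [div_le_div_iff₀ (by positivity) (by positivity)]
  have h1 : ((n : ℝ) + 1 + 2 * l) * (n + 1 + 2 * l) ≤ (2 * (n + 1 + l)) * (2 * (n + 2)) := by
    gcongr <;> linarith
  have h2 : ((n : ℝ) + 1) * ((n + 1 + 2 * l) * (n + 1 + 2 * l)) ≤
      (n + 2) * ((2 * (n + 1 + l)) * (2 * (n + 2))) := by
    gcongr
    linarith
  linarith

/-- The cutoff that is `1` on `[1, M]` and decreases linearly to `0` at `2 M`. -/
noncomputable def hardyCutoff (M n : ℕ) : ℝ :=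
  if n = 0 then 0 else if n ≤ M then 1 else (2 * M - n) / M

theorem hardyCutoff_of_le {M n : ℕ} (hn : n ≠ 0) (hM : n ≤ M) : hardyCutoff M n = 1 := by
  rw [hardyCutoff, if_neg hn, if_pos hM]

theorem hardyCutoff_of_ge {M n : ℕ} (hM : 0 < M) (hn : M ≤ n) :
    hardyCutoff M n = (2 * M - n) / M := by
  have h : (M : ℝ) ≠ 0 := by positivity
  rw [hardyCutoff, if_neg (by omega)]
  split_ifs with h1
  · have : n = M := le_antisymm h1 hn
    subst this
    field_simp
    ring
  · rfl

/-- The slope `1/M` of the cutoff costs about `n/M²` per edge. Over the `M` edges of the ramp this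
stays bounded, while the main sums diverge logarithmically. -/
theorem hardyCutoff_mul_sub_sq_le {l : ℝ} (hl : 0 ≤ l) {M n : ℕ} (hM : 0 < M) (hn : M ≤ n)
    (hn2 : n < 2 * M) :
    gegenbauerEdge l n * (hardyTest l n * hardyCutoff M n -
      hardyTest l (n + 1) * hardyCutoff M (n + 1)) ^ 2 ≤
      (2 * (2 * l - 1) ^ 2 + 6) / M := by
  have hl' : -1 / 2 < l := by linarith
  have he := gegenbauerEdge_pos hl' n
  have hM0 : (0 : ℝ) < M := by exact_mod_cast hM
  have hM1 : (1 : ℝ) ≤ M := by exact_mod_cast hM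
  have hnM : (M : ℝ) ≤ n := by exact_mod_cast hn
  have hn2M : (n : ℝ) + 1 ≤ 2 * M := by exact_mod_cast hn2
  set ψ := hardyCutoff M n with hψ
  have hψ' : hardyCutoff M (n + 1) = ψ - 1 / M := by
    rw [hψ, hardyCutoff_of_ge hM hn, hardyCutoff_of_ge hM (by omega)]
    push_cast
    field_simp
    ring
  have hψ0 : 0 ≤ ψ := by
    rw [hψ, hardyCutoff_of_ge hM hn]
    exact div_nonneg (by linarith) hM0.le
  have hψ1 : ψ ≤ 1 := by
    rw [hψ, hardyCutoff_of_ge hM hn, div_le_one hM0]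
    linarith
  have hψ2 : ψ ^ 2 ≤ 1 := pow_le_one₀ hψ0 hψ1
  have h1 := hardyTest_sub_sq_le hl n
  have h2 : gegenbauerEdge l n * hardyTest l (n + 1) ^ 2 ≤ 3 * M := by
    have h3 := hardyTest_sq hl' (n + 1)
    have h4 : gegenbauerEdge l n ≤ gegenbauerEdge l (n + 1) := by
      rw [gegenbauerEdge]
      refine le_mul_of_one_le_right he.le ?_
      rw [one_le_div (by positivity)]
      linarith
    have h5 := mul_le_mul_of_nonneg_right h4 (sq_nonneg (hardyTest l (n + 1)))
    push_cast at h3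
    linarith
  have h6 : (2 * l - 1) ^ 2 / ((n : ℝ) + 1) ≤ (2 * l - 1) ^ 2 / M := by
    gcongr
    linarith
  set a := hardyTest l n - hardyTest l (n + 1) with ha
  rw [hψ']
  calc gegenbauerEdge l n * (hardyTest l n * ψ - hardyTest l (n + 1) * (ψ - 1 / M)) ^ 2
      = gegenbauerEdge l n * (a * ψ + hardyTest l (n + 1) / M) ^ 2 := by
        rw [ha]
        ring
    _ ≤ gegenbauerEdge l n * (2 * ((a * ψ) ^ 2 + (hardyTest l (n + 1) / M) ^ 2)) := by
        gcongr
        exact add_sq_le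
    _ = 2 * (gegenbauerEdge l n * a ^ 2) * ψ ^ 2 +
        2 * (gegenbauerEdge l n * hardyTest l (n + 1) ^ 2) / M ^ 2 := by
        ring
    _ ≤ 2 * ((2 * l - 1) ^ 2 / M) * 1 + 2 * (3 * M) / M ^ 2 := by
        gcongr
        linarith
    _ = (2 * (2 * l - 1) ^ 2 + 6) / M := by
        field_simp
        ring

theorem sum_hardyCutoff_le {l : ℝ} (hl : 0 ≤ l) {M : ℕ} (hM : 0 < M) :
    ∑ n ∈ Finset.range (2 * M), gegenbauerEdge l n * (hardyTest l n * hardyCutoff M n -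
      hardyTest l (n + 1) * hardyCutoff M (n + 1)) ^ 2 ≤
    ∑ n ∈ Finset.range M, gegenbauerEdge l n * (hardyTest l n - hardyTest l (n + 1)) ^ 2 +
      (hardyTest l 1 ^ 2 + (2 * (2 * l - 1) ^ 2 + 6)) := by
  have hl' : -1 / 2 < l := by linarith
  rw [← Finset.sum_range_add_sum_Ico _ (by omega : M ≤ 2 * M)]
  have h1 : ∑ n ∈ Finset.range M, gegenbauerEdge l n * (hardyTest l n * hardyCutoff M n -
      hardyTest l (n + 1) * hardyCutoff M (n + 1)) ^ 2 ≤
      ∑ n ∈ Finset.range M, gegenbauerEdge l n * (hardyTest l n - hardyTest l (n + 1)) ^ 2 +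
      hardyTest l 1 ^ 2 := by
    obtain ⟨K, rfl⟩ : ∃ K, M = K + 1 := ⟨M - 1, by omega⟩
    rw [Finset.sum_range_succ', Finset.sum_range_succ']
    have h2 : ∀ n ∈ Finset.range K, gegenbauerEdge l (n + 1) * (hardyTest l (n + 1) *
        hardyCutoff (K + 1) (n + 1) -
        hardyTest l (n + 1 + 1) * hardyCutoff (K + 1) (n + 1 + 1)) ^ 2 =
        gegenbauerEdge l (n + 1) * (hardyTest l (n + 1) - hardyTest l (n + 1 + 1)) ^ 2 := by
      intro n hn
      have := Finset.mem_range.1 hn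
      rw [hardyCutoff_of_le (by omega) (by omega), hardyCutoff_of_le (by omega) (by omega),
        mul_one, mul_one]
    rw [Finset.sum_congr rfl h2, hardyCutoff_of_le (n := 0 + 1) (by omega) (by omega)]
    have h3 : hardyCutoff (K + 1) 0 = 0 := by simp [hardyCutoff]
    have h4 : 0 ≤ gegenbauerEdge l 0 * (hardyTest l 0 - hardyTest l (0 + 1)) ^ 2 :=
      mul_nonneg (gegenbauerEdge_pos hl' 0).le (sq_nonneg _)
    rw [h3]
    simp only [gegenbauerEdge, mul_zero, zero_add, mul_one, one_mul, zero_sub, neg_sq] at h4 ⊢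
    linarith
  have h2 : ∑ n ∈ Finset.Ico M (2 * M), gegenbauerEdge l n * (hardyTest l n * hardyCutoff M n -
      hardyTest l (n + 1) * hardyCutoff M (n + 1)) ^ 2 ≤ 2 * (2 * l - 1) ^ 2 + 6 := by
    have h3 := Finset.sum_le_card_nsmul (Finset.Ico M (2 * M)) _ _ fun n hn =>
      hardyCutoff_mul_sub_sq_le hl hM (Finset.mem_Ico.1 hn).1 (Finset.mem_Ico.1 hn).2
    refine h3.trans (le_of_eq ?_)
    have hM0 : (M : ℝ) ≠ 0 := by positivity
    rw [Nat.card_Ico, nsmul_eq_mul, (by omega : 2 * M - M = M)]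
    field_simp
  linarith

/-- The constant `8 / (2 l - 1) ^ 2` cannot be improved in the Hardy–Rellich inequality. -/
theorem IsHardyRellichConst.one_le_mul {l C : ℝ} (hl : 0 ≤ l) (hl2 : l ≤ 3 / 2)
    (hC : IsHardyRellichConst l C) : 1 ≤ C * ((2 * l - 1) ^ 2 / 8) := by
  by_contra! hlt
  have hl' : -1 / 2 < l := by linarith
  -- If `C` were too small, eventually `C α ≤ θ β` with `θ < 1`. The truncated inequality would then
  -- bound `(1 - θ) Σ β`, but `Σ β` dominates half a harmonic sum up to a constant.
  obtain ⟨θ, hθ, hθ1⟩ := exists_between hlt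
  set α : ℕ → ℝ := fun n =>
    gegenbauerEdge l n * (hardyTest l n - hardyTest l (n + 1)) ^ 2 with hα
  set β : ℕ → ℝ := fun n =>
    gegenbauerMass l n * hardyTest l n ^ 2 / ((n : ℝ) * (n + 2 * l)) with hβ
  have hα0 : ∀ n, 0 ≤ α n := fun n => mul_nonneg (gegenbauerEdge_pos hl' n).le (sq_nonneg _)
  have hβ0 : ∀ n, 0 ≤ β n := fun n => div_nonneg
    (mul_nonneg (gegenbauerMass_pos hl' n).le (sq_nonneg _)) (gegenbauerEigenvalue_nonneg hl' n)
  have hθ0 : 0 < θ := lt_of_le_of_lt (mul_nonneg hC.1.le (by positivity)) hθ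
  obtain ⟨N, hN⟩ := eventually_atTop.1 (eventually_hardyTest_le hl hC.1 hθ)
  set K := hardyTest l 1 ^ 2 + (2 * (2 * l - 1) ^ 2 + 6) with hK
  have hαβ : ∀ M, C * ∑ n ∈ Finset.range M, α n ≤
      θ * ∑ n ∈ Finset.range M, β n + C * ∑ n ∈ Finset.range N, α n := by
    intro M
    have h1 : ∀ n ∈ Finset.range M, C * α n ≤ θ * β n + if n < N then C * α n else 0 := by
      intro n _
      split_ifs with h
      · exact le_add_of_nonneg_left (mul_nonneg hθ0.le (hβ0 n))
      · rw [add_zero]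
        exact hN n (not_lt.1 h)
    have h2 : ∑ n ∈ Finset.range M, (if n < N then C * α n else 0) ≤
        ∑ n ∈ Finset.range N, C * α n := by
      rw [← Finset.sum_filter]
      refine Finset.sum_le_sum_of_subset_of_nonneg (fun n hn => ?_)
        fun n _ _ => mul_nonneg hC.1.le (hα0 n)
      exact Finset.mem_range.2 (Finset.mem_filter.1 hn).2
    have h3 := Finset.sum_le_sum h1
    rw [Finset.sum_add_distrib] at h3
    simp only [← Finset.mul_sum] at h2 h3
    linarith
  have hmain : ∀ M, 0 < M → ∑ n ∈ Finset.range M, β n ≤ C * (∑ n ∈ Finset.range M, α n + K) := by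
    intro M hM
    have h1 := hC.sum_le hl' (c := fun n => hardyTest l n * hardyCutoff M n) (M := 2 * M - 1)
      (by simp [hardyCutoff]) (by
        rw [hardyCutoff_of_ge hM (by omega), (by omega : 2 * M - 1 + 1 = 2 * M)]
        simp)
    rw [(by omega : 2 * M - 1 + 1 = 2 * M)] at h1
    refine le_trans ?_ (h1.trans (mul_le_mul_of_nonneg_left (sum_hardyCutoff_le hl hM) hC.1.le))
    refine le_trans (Finset.sum_le_sum fun n hn => ?_) (Finset.sum_le_sum_of_subset_of_nonneg
      (Finset.range_mono (by omega : M ≤ 2 * M)) fun n _ _ => div_nonneg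
      (mul_nonneg (gegenbauerMass_pos hl' n).le (sq_nonneg _)) (gegenbauerEigenvalue_nonneg hl' n))
    rcases Nat.eq_zero_or_pos n with rfl | h0
    · simp [hβ]
    · rw [hardyCutoff_of_le h0.ne' (Finset.mem_range.1 hn).le, mul_one]
  have hbound : ∀ M, 0 < M → (1 - θ) * ∑ n ∈ Finset.range M, β n ≤
      C * ∑ n ∈ Finset.range N, α n + C * K := by
    intro M hM
    have h1 := hmain M hM
    have h2 := hαβ M
    rw [mul_add] at h1
    linarith
  have hharm : ∀ M, ∑ n ∈ Finset.range (M + 1), 1 / ((n : ℝ) + 1) ≤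
      2 * ∑ n ∈ Finset.range (M + 1), β n + 1 := by
    intro M
    rw [Finset.sum_range_succ', Finset.sum_range_succ' β, mul_add,
      Finset.mul_sum]
    have h1 : ∀ n ∈ Finset.range M, 1 / (((n + 1 : ℕ) : ℝ) + 1) ≤ 2 * β (n + 1) := fun n _ => by
      have := hardyTest_mass_ge hl hl2 n
      have h2 : 1 / (((n + 1 : ℕ) : ℝ) + 1) = 2 * (1 / (2 * (((n + 1 : ℕ) : ℝ) + 1))) := by
        field_simp
      rw [h2]
      exact mul_le_mul_of_nonneg_left this (by norm_num)
    have h2 := Finset.sum_le_sum h1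
    have h3 := hβ0 0
    simp only [Nat.cast_zero, zero_add, div_one]
    linarith
  have hdiv := (Real.tendsto_sum_range_one_div_nat_succ_atTop.comp
    (tendsto_add_atTop_nat 1)).eventually_gt_atTop
    (2 * ((C * ∑ n ∈ Finset.range N, α n + C * K) / (1 - θ)) + 1)
  obtain ⟨M, hM⟩ := hdiv.exists
  have h1 := hharm M
  have h2 := hbound (M + 1) (Nat.succ_pos M)
  rw [mul_comm, ← le_div_iff₀ (by linarith)] at h2
  simp only [Function.comp] at hM
  linarith

/-! ### Duality between Hardy–Rellich and the uncertainty principle -/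

theorem one_add_le_gegenbauerEigenvalue {l : ℝ} (hl : -1 / 2 < l) (n : ℕ) :
    1 + 2 * l ≤ ((n + 1 : ℕ) : ℝ) * ((n + 1 : ℕ) + 2 * l) := by
  push_cast
  have : (0 : ℝ) ≤ n := n.cast_nonneg
  nlinarith

/-- The Hardy–Rellich inequality implies the uncertainty principle, by duality. -/
theorem IsHardyRellichConst.uncertainty {l C : ℝ} (hl : -1 / 2 < l)
    (hC : IsHardyRellichConst l C) {f g : ℝ → ℝ} (hfg : IsGegenbauerPower l (1 / 2) f g)
    (hf0 : ∫ t, f t ∂(gegenbauerMeasure l) = 0) :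
    (∫ t, |f t| ^ 2 ∂(gegenbauerMeasure l)) ^ 2 ≤
      C * ((∫ t, (1 - t) * |f t| ^ 2 ∂(gegenbauerMeasure l)) *
        ∫ t, |g t| ^ 2 ∂(gegenbauerMeasure l)) := by
  rw [← gegenbauerCoeff_zero] at hf0
  -- Coefficients of `h = (-D)^{-1/2} f`, possible since `f` has mean zero. As `-D h = g`, the
  -- function `h` lies in `W_2^1` although `f` is only in `W_2^{1/2}`.
  set d : ℕ → ℝ := fun n => gegenbauerCoeff l f n / ((n : ℝ) * (n + 2 * l)) ^ (1 / 2 : ℝ) with hd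
  have hcd : ∀ n : ℕ, gegenbauerCoeff l f n = ((n : ℝ) * (n + 2 * l)) ^ (1 / 2 : ℝ) * d n :=
    fun n => by
    cases n with
    | zero => simp [hd, hf0]
    | succ n =>
      have := (Real.rpow_pos_of_pos (gegenbauerEigenvalue_pos hl n) (1 / 2 : ℝ)).ne'
      rw [hd]
      dsimp only
      field_simp
  have hcg : ∀ n : ℕ, gegenbauerCoeff l g n =
      ((n : ℝ) * (n + 2 * l)) ^ (1 / 2 : ℝ) * gegenbauerCoeff l f n := hfg.2.2
  have h2l : 0 < 1 + 2 * l := by linarith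
  have hsq := (hasSum_gegenbauerCoeff_sq hl hfg.1).summable
  have hsum : Summable fun n => gegenbauerMass l n * d n ^ 2 := by
    refine (hsq.mul_left (1 + 2 * l)⁻¹).of_nonneg_of_le
      (fun n => mul_nonneg (gegenbauerMass_pos hl n).le (sq_nonneg _)) fun n => ?_
    cases n with
    | zero => simp [hd, hf0]
    | succ n =>
      have h1 : d (n + 1) ^ 2 =
          gegenbauerCoeff l f (n + 1) ^ 2 / (((n + 1 : ℕ) : ℝ) * ((n + 1 : ℕ) + 2 * l)) := by
        rw [hd]
        dsimp only
        rw [div_pow, ← Real.sqrt_eq_rpow, Real.sq_sqrt (gegenbauerEigenvalue_nonneg hl _)]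
      rw [h1, inv_mul_eq_div, mul_div_assoc']
      exact div_le_div_of_nonneg_left (mul_nonneg (gegenbauerMass_pos hl _).le (sq_nonneg _)) h2l
        (one_add_le_gegenbauerEigenvalue hl n)
  obtain ⟨h, hh, hhd⟩ := exists_gegenbauerCoeff_eq hl hsum
  have hpow : IsGegenbauerPower l (1 / 2) h f := ⟨hh, hfg.1, fun n => by
    rw [← gegenbauerCoeff, ← gegenbauerCoeff, hhd, ← hcd]⟩
  have hsob : IsGegenbauerPower l 1 h g := ⟨hh, hfg.2.1, fun n => by
    rw [← gegenbauerCoeff, ← gegenbauerCoeff, hhd, hcg, hcd, ← mul_assoc, ← Real.sqrt_eq_rpow,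
      Real.mul_self_sqrt (gegenbauerEigenvalue_nonneg hl n), Real.rpow_one]⟩
  have hmean : ∫ t, h t ∂(gegenbauerMeasure l) = 0 := by
    rw [← gegenbauerCoeff_zero, hhd]
    simp [hd, hf0]
  have hHR := hC.2 h f ⟨g, hsob⟩ hmean hpow
  have hinner : ∫ t, h t * g t ∂(gegenbauerMeasure l) =
      ∫ t, |f t| ^ 2 ∂(gegenbauerMeasure l) := by
    refine (hasSum_gegenbauerCoeff_mul hl hh hfg.2.1).unique ?_
    refine (hasSum_gegenbauerCoeff_sq hl hfg.1).congr_fun fun n => ?_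
    rw [hhd, hcg, hcd]
    ring
  rw [← hinner, ← mul_assoc]
  exact (sq_integral_mul_le hh hfg.2.1).trans
    (mul_le_mul_of_nonneg_right hHR (integral_nonneg fun _ => by positivity))

/-! ### The Heisenberg inequality and the case `l = 1/2` -/

theorem gegenbauerOp_gegenbauerSum {l : ℝ} (hl : -1 / 2 < l) (c : ℕ → ℝ) (M : ℕ) :
    gegenbauerOp l (gegenbauerSum l c M) =
      gegenbauerSum l (fun n => -((n : ℝ) * (n + 2 * l)) * c n) M := by
  have h : ∀ n, gegenbauerOp l (Polynomial.C (gegenbauerMass l n * c n) * gegenbauerPoly l n) =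
      Polynomial.C (gegenbauerMass l n * (-((n : ℝ) * (n + 2 * l)) * c n)) *
        gegenbauerPoly l n := fun n => by
    have h1 := gegenbauerOp_gegenbauerPoly hl n
    simp only [gegenbauerOp, Polynomial.derivative_mul, Polynomial.derivative_C, zero_mul,
      zero_add] at h1 ⊢
    simp only [map_mul, map_neg] at h1 ⊢
    linear_combination Polynomial.C (gegenbauerMass l n) * Polynomial.C (c n) * h1
  simp only [gegenbauerSum, ← h]
  simp only [gegenbauerOp, Polynomial.derivative_sum, Finset.mul_sum, ← Finset.sum_sub_distrib]

/-- The Heisenberg uncertainty inequality for polynomials. -/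
theorem heisenberg_polynomial {l : ℝ} (hl : -1 / 2 < l) (p : Polynomial ℝ) :
    ((2 * l + 1) * ∫ t, t * |p.eval t| ^ 2 ∂(gegenbauerMeasure l)) ^ 2 *
        ∫ t, |p.eval t| ^ 2 ∂(gegenbauerMeasure l) ≤
      4 * (-∫ t, (gegenbauerOp l p).eval t * p.eval t ∂(gegenbauerMeasure l)) *
        ((∫ t, |p.eval t| ^ 2 ∂(gegenbauerMeasure l)) ^ 2 -
          (∫ t, t * |p.eval t| ^ 2 ∂(gegenbauerMeasure l)) ^ 2) := by
  rw [integral_gegenbauerOp_mul hl, neg_neg]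
  set F := ∫ t, |p.eval t| ^ 2 ∂(gegenbauerMeasure l) with hF
  set T := ∫ t, t * |p.eval t| ^ 2 ∂(gegenbauerMeasure l) with hT
  have hF0 : 0 ≤ F := integral_nonneg fun _ => by positivity
  have hcont : Continuous fun t : ℝ => √(1 - t ^ 2) := by fun_prop
  have hsqrt : ∀ q r : Polynomial ℝ, ∫ t, √(1 - t ^ 2) * q.eval t * (√(1 - t ^ 2) * r.eval t)
      ∂(gegenbauerMeasure l) = ∫ t, (1 - t ^ 2) * (q.eval t * r.eval t) ∂(gegenbauerMeasure l) :=
    fun q r => by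
    refine integral_congr_ae ?_
    filter_upwards [ae_mem_Ioo_gegenbauerMeasure l] with t ht
    linear_combination q.eval t * r.eval t * Real.mul_self_sqrt (one_sub_sq_pos ht).le
  set G := ∫ t, (1 - t ^ 2) * (p.derivative.eval t * p.derivative.eval t)
    ∂(gegenbauerMeasure l) with hG
  set S := ∫ t, |t * p.eval t| ^ 2 ∂(gegenbauerMeasure l) with hS
  -- Integration by parts turns `T` into a pairing of `p` with `p'` under the weight `1 - t²`.
  -- Cauchy–Schwarz bounds its square by `(F - S) G`, and `T² ≤ S F` then eliminates `S`.
  have hparts : (2 * l + 1) * T =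
      2 * ∫ t, (1 - t ^ 2) * (p.eval t * p.derivative.eval t) ∂(gegenbauerMeasure l) := by
    have h := integral_gegenbauer_divergence hl (p * p)
    rw [hT, ← sub_eq_zero, ← integral_const_mul, ← integral_const_mul,
      ← integral_sub (integrable_of_continuous hl (by fun_prop))
        (integrable_of_continuous hl (by fun_prop)), ← neg_eq_zero, ← integral_neg, ← h]
    congr 1
    ext t
    rw [sq_abs]
    simp only [Polynomial.derivative_mul, Polynomial.eval_add, Polynomial.eval_mul]
    ring
  have hFS : ∫ t, (1 - t ^ 2) * (p.eval t * p.eval t) ∂(gegenbauerMeasure l) = F - S := by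
    rw [hF, hS, ← integral_sub (integrable_of_continuous hl (by fun_prop))
      (integrable_of_continuous hl (by fun_prop))]
    congr 1
    ext t
    rw [sq_abs, sq_abs]
    ring
  have hCS1 := sq_integral_mul_le
    (memLp_of_continuous hl (hcont.mul p.continuous))
    (memLp_of_continuous hl (hcont.mul p.derivative.continuous))
  simp only [sq_abs, Pi.mul_apply] at hCS1
  have hsq : ∀ q : Polynomial ℝ, ∫ t, (√(1 - t ^ 2) * q.eval t) ^ 2 ∂(gegenbauerMeasure l) =
      ∫ t, (1 - t ^ 2) * (q.eval t * q.eval t) ∂(gegenbauerMeasure l) := fun q => by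
    rw [← hsqrt]
    congr 1
    ext t
    ring
  rw [hsqrt, hsq, hsq, hFS] at hCS1
  rw [← hG] at hCS1
  have hCS2 := sq_integral_mul_le
    (memLp_of_continuous hl (continuous_id.mul p.continuous))
    (memLp_of_continuous hl p.continuous)
  simp only [Pi.mul_apply, id] at hCS2
  have hT2 : ∫ t, t * p.eval t * p.eval t ∂(gegenbauerMeasure l) = T := by
    rw [hT]
    congr 1
    ext t
    rw [sq_abs]
    ring
  rw [hT2, ← hS, ← hF] at hCS2
  have hG0 : 0 ≤ G := by
    refine integral_nonneg_of_ae ?_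
    filter_upwards [ae_mem_Ioo_gegenbauerMeasure l] with t ht
    exact mul_nonneg (one_sub_sq_pos ht).le (mul_self_nonneg _)
  have h1 := mul_le_mul_of_nonneg_right hCS1 hF0
  have h2 := mul_le_mul_of_nonneg_left hCS2 hG0
  rw [hparts]
  linarith

/-- The Heisenberg uncertainty inequality for Gegenbauer expansions. -/
theorem IsGegenbauerPower.heisenberg {l : ℝ} (hl : -1 / 2 < l) {f g : ℝ → ℝ}
    (hfg : IsGegenbauerPower l (1 / 2) f g) :
    ((2 * l + 1) * ∫ t, t * |f t| ^ 2 ∂(gegenbauerMeasure l)) ^ 2 *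
        ∫ t, |f t| ^ 2 ∂(gegenbauerMeasure l) ≤
      4 * (∫ t, |g t| ^ 2 ∂(gegenbauerMeasure l)) *
        ((∫ t, |f t| ^ 2 ∂(gegenbauerMeasure l)) ^ 2 -
          (∫ t, t * |f t| ^ 2 ∂(gegenbauerMeasure l)) ^ 2) := by
  have hF := (hasSum_gegenbauerCoeff_sq hl hfg.1).tendsto_sum_nat.comp (tendsto_add_atTop_nat 1)
  have hG := (hasSum_gegenbauerCoeff_sq hl hfg.2.1).tendsto_sum_nat.comp (tendsto_add_atTop_nat 1)
  have hT := (hasSum_gegenbauerEdge hl hfg.1).tendsto_sum_nat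
  -- Both sides depend continuously on three quantities that are limits of their values on
  -- Gegenbauer partial sums; `M + 1` coefficients span `M` edges, hence the shifted indices.
  refine le_of_tendsto_of_tendsto' (((hT.const_mul _).pow 2).mul hF)
    ((hG.const_mul 4).mul ((hF.pow 2).sub (hT.pow 2))) fun M => ?_
  have h := heisenberg_polynomial hl (gegenbauerSum l (gegenbauerCoeff l f) (M + 1))
  rw [integral_mul_sq_gegenbauerSum hl, integral_sq_gegenbauerSum hl] at h
  have hop : -∫ t, (gegenbauerOp l (gegenbauerSum l (gegenbauerCoeff l f) (M + 1))).eval t *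
      (gegenbauerSum l (gegenbauerCoeff l f) (M + 1)).eval t ∂(gegenbauerMeasure l) =
      ∑ n ∈ Finset.range (M + 1), gegenbauerMass l n * gegenbauerCoeff l g n ^ 2 := by
    rw [gegenbauerOp_gegenbauerSum hl, neg_eq_iff_eq_neg, ← Finset.sum_neg_distrib]
    refine (hasSum_gegenbauerCoeff_mul hl (memLp_gegenbauerSum hl _ _)
      (memLp_gegenbauerSum hl _ _)).unique ?_
    have h1 : ∀ n ∈ Finset.range (M + 1), -(gegenbauerMass l n * gegenbauerCoeff l g n ^ 2) =
        gegenbauerMass l n * gegenbauerCoeff l (fun t => (gegenbauerSum l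
          (fun n => -((n : ℝ) * (n + 2 * l)) * gegenbauerCoeff l f n) (M + 1)).eval t) n *
        gegenbauerCoeff l
          (fun t => (gegenbauerSum l (gegenbauerCoeff l f) (M + 1)).eval t) n := fun n hn => by
      rw [gegenbauerCoeff_gegenbauerSum hl, gegenbauerCoeff_gegenbauerSum hl,
        if_pos (Finset.mem_range.1 hn), if_pos (Finset.mem_range.1 hn), hfg.coeff_sq hl]
      ring
    rw [Finset.sum_congr rfl h1]
    refine hasSum_sum_of_ne_finset_zero fun n hn => ?_
    rw [gegenbauerCoeff_gegenbauerSum hl, if_neg (Finset.mem_range.not.1 hn), mul_zero, zero_mul]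
  rw [hop] at h
  exact h

theorem IsGegenbauerPower.spectral_gap {l : ℝ} (hl : -1 / 2 < l) {f g : ℝ → ℝ}
    (hfg : IsGegenbauerPower l (1 / 2) f g) (hf0 : ∫ t, f t ∂(gegenbauerMeasure l) = 0) :
    (1 + 2 * l) * ∫ t, |f t| ^ 2 ∂(gegenbauerMeasure l) ≤
      ∫ t, |g t| ^ 2 ∂(gegenbauerMeasure l) := by
  rw [← gegenbauerCoeff_zero] at hf0
  refine hasSum_le (fun n => ?_) ((hasSum_gegenbauerCoeff_sq hl hfg.1).mul_left (1 + 2 * l))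
    (hasSum_gegenbauerCoeff_sq hl hfg.2.1)
  rw [hfg.coeff_sq hl]
  cases n with
  | zero => simp [hf0]
  | succ n =>
    have h := mul_le_mul_of_nonneg_right (one_add_le_gegenbauerEigenvalue hl n)
      (mul_nonneg (gegenbauerMass_pos hl (n + 1)).le (sq_nonneg (gegenbauerCoeff l f (n + 1))))
    linarith

/-- The uncertainty principle for `l = 1 / 2`, that is, on the two-dimensional sphere. -/
theorem IsGegenbauerPower.uncertainty_half {f g : ℝ → ℝ}
    (hfg : IsGegenbauerPower (1 / 2) (1 / 2) f g)
    (hf0 : ∫ t, f t ∂(gegenbauerMeasure (1 / 2)) = 0)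
    (hf1 : ∫ t, |f t| ^ 2 ∂(gegenbauerMeasure (1 / 2)) = 1) :
    2 - 2 * √6 / 3 ≤ (∫ t, (1 - t) * |f t| ^ 2 ∂(gegenbauerMeasure (1 / 2))) *
      ∫ t, |g t| ^ 2 ∂(gegenbauerMeasure (1 / 2)) := by
  have hl : (-1 / 2 : ℝ) < 1 / 2 := by norm_num
  have hH := hfg.heisenberg hl
  have hgap := hfg.spectral_gap hl hf0
  have hX : 0 ≤ ∫ t, (1 - t) * |f t| ^ 2 ∂(gegenbauerMeasure (1 / 2)) := by
    refine integral_nonneg_of_ae ?_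
    filter_upwards [ae_mem_Ioo_gegenbauerMeasure (1 / 2)] with t ht
    exact mul_nonneg (by linarith [ht.2]) (by positivity)
  rw [integral_one_sub_mul_sq hfg.1] at hX ⊢
  rw [hf1] at hH hgap hX ⊢
  set T := ∫ t, t * |f t| ^ 2 ∂(gegenbauerMeasure (1 / 2))
  set G := ∫ t, |g t| ^ 2 ∂(gegenbauerMeasure (1 / 2))
  have hH' : T ^ 2 ≤ G * (1 - T ^ 2) := by linarith
  have hG : 2 ≤ G := by linarith
  have h6 : √6 ^ 2 = 6 := Real.sq_sqrt (by norm_num)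
  have h60 : 0 ≤ √6 := Real.sqrt_nonneg 6
  -- The gap gives `(1-T)G ≥ 2(1-T)`, decreasing in `T`, and Heisenberg gives `(1-T)G ≥ T²/(1+T)`,
  -- increasing for `T ≥ 0`. They meet at `T² = 2/3`, with common value `2 - 2√6/3`.
  rcases le_total T (√6 / 3) with h | h
  · nlinarith
  · have hT0 : 0 ≤ T := by linarith [div_nonneg h60 (by norm_num : (0 : ℝ) ≤ 3)]
    have h1 : 0 < 1 + T := by linarith
    refine le_of_mul_le_mul_right (le_trans ?_ (hH'.trans_eq (by ring :
      G * (1 - T ^ 2) = (1 - T) * G * (1 + T)))) h1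
    have h63 : √6 ≤ 3 := by nlinarith
    nlinarith [mul_nonneg (sub_nonneg.2 h) hT0, mul_nonneg (sub_nonneg.2 h) h60]

theorem two_sub_two_mul_sqrt_six_div_three_pos : 0 < 2 - 2 * √6 / 3 := by
  have h : √6 < 3 := (Real.sqrt_lt' (by norm_num)).2 (by norm_num)
  linarith

/-! ### The best constants and the theorem -/

theorem isLeast_isHardyRellichConst_of_nonneg_of_le {l : ℝ} (hl : 0 ≤ l) (hl2 : l ≤ 3 / 2)
    (hne : l ≠ 1 / 2) :
    IsLeast {C : ℝ | IsHardyRellichConst l C} ((2 * l - 1) ^ 2 / 8)⁻¹ := by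
  refine ⟨?_, fun C hC => ?_⟩
  · rcases lt_or_gt_of_ne hne with h | h
    · exact isHardyRellichConst_of_nonneg_of_lt_half hl h
    · exact isHardyRellichConst_of_half_lt_of_le h hl2
  · have h : (2 * l - 1) ≠ 0 := fun h => hne (by linarith)
    exact (inv_le_iff_one_le_mul₀ (by positivity)).2 (hC.one_le_mul hl hl2)

theorem mainTheorem8 (l : ℝ) (hl : -1 / 2 < l) :
    ∃ B : ℝ, 0 < B ∧
      (l = 1 / 2 → B = 2 - 2 * Real.sqrt 6 / 3) ∧
      (l ≠ 1 / 2 → IsLeast {C : ℝ | IsHardyRellichConst l C} B⁻¹) ∧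
      (0 ≤ l → l ≤ 3 / 2 → l ≠ 1 / 2 → B = (2 * l - 1) ^ 2 / 8) ∧
      ∀ f g : ℝ → ℝ, IsGegenbauerPower l (1 / 2) f g →
        ∫ t, f t ∂(gegenbauerMeasure l) = 0 →
        ∫ t, |f t| ^ 2 ∂(gegenbauerMeasure l) = 1 →
        B ≤ (∫ t, (1 - t) * |f t| ^ 2 ∂(gegenbauerMeasure l)) *
          ∫ t, |g t| ^ 2 ∂(gegenbauerMeasure l) := by
  by_cases h : l = 1 / 2
  · subst h
    exact ⟨2 - 2 * √6 / 3, two_sub_two_mul_sqrt_six_div_three_pos, fun _ => rfl,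
      fun h => absurd rfl h, fun _ _ h => absurd rfl h,
      fun f g hfg hf0 hf1 => hfg.uncertainty_half hf0 hf1⟩
  · have hleast := isLeast_isHardyRellichConst hl h
    have hpos := hleast.1.1
    refine ⟨(sInf {C : ℝ | IsHardyRellichConst l C})⁻¹, inv_pos.2 hpos, fun h' => absurd h' h,
      fun _ => by rwa [inv_inv], fun h0 h1 _ => ?_, fun f g hfg hf0 hf1 => ?_⟩
    · rw [hleast.unique (isLeast_isHardyRellichConst_of_nonneg_of_le h0 h1 h), inv_inv]
    · have := hleast.1.uncertainty hl hfg hf0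
      rw [hf1, one_pow] at this
      exact (inv_le_iff_one_le_mul₀' hpos).2 this
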